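/- Let $n\ge 0$ and let $w\in S_n$. Write $s_i$ for the adjacent transposition $(i\ i{+}1)$, $\ell$ for Coxeter length with respect to $s_1,\dots,s_{n-1}$, and $\operatorname{supp}(w)$ for the set of letters $i$ such that $s_i$ occurs in some reduced word of $w$. Call $w$ fully commutative if any two of its reduced words are related by a sequence of moves interchanging adjacent letters $i,j$ with $|i-j|>1$, and boolean if its principal order ideal in the Bruhat order is isomorphic to a boolean algebra. Let $P(w)$ be the insertion tableau of the one-line notation $w(1)w(2)\cdots w(n)$ under the Robinson–Schensted correspondence. A set $L$ of integers is uncrowded if $|[y,y+2x]\cap L|\le x+1$ for all integers $x,y$ with $x>0$; a permutation $w$ is uncrowded if $P(w)$ has at most two rows and the set of entries of its second row is uncrowded. Let $w\in S_n$ be fully commutative. Then there is a unique boolean permutation $\hat w\in S_n$, the boolean core of $w$, such that $\operatorname{supp}(\hat w)=\operatorname{supp}(w)$ and $w=\hat w w'$ for some $w'\in S_n$ with $\ell(w)=\ell(\hat w)+\ell(w')$. Moreover, $w$ is uncrowded if and only if $P(\hat w)=P(w)$. -/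

import Mathlib

namespace FCPerm

/-! Permutations of `{1, …, n}` are elements of `Equiv.Perm (Fin n)`; the element `i : Fin n` stands
for the number `i + 1`, and the letter `i : Fin (n - 1)` of a word stands for the letter `i + 1`. -/

/-- The simple reflection (adjacent transposition). -/
def simpleReflection {n : ℕ} (i : Fin (n - 1)) : Equiv.Perm (Fin n) :=
  Equiv.swap ⟨i, by omega⟩ ⟨i + 1, by omega⟩

/-- The product of the simple reflections spelled out by a word. -/
def wordProd {n : ℕ} (u : List (Fin (n - 1))) : Equiv.Perm (Fin n) :=
  (u.map simpleReflection).prod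

/-- The Coxeter length: the minimal number of simple reflections in an expression for `w`. -/
noncomputable def length {n : ℕ} (w : Equiv.Perm (Fin n)) : ℕ :=
  sInf {k | ∃ u : List (Fin (n - 1)), u.length = k ∧ wordProd u = w}

/-- The set `R(w)` of reduced words of `w`. -/
def reducedWords {n : ℕ} (w : Equiv.Perm (Fin n)) : Set (List (Fin (n - 1))) :=
  {u | wordProd u = w ∧ u.length = length w}

/-- The support of `w`: the letters appearing in reduced words of `w`. -/
def supp {n : ℕ} (w : Equiv.Perm (Fin n)) : Set (Fin (n - 1)) :=
  {i | ∃ u ∈ reducedWords w, i ∈ u}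

/-- One commutation move: two adjacent letters `i`, `j` with `|i - j| > 1` are interchanged. -/
def CommutationMove {n : ℕ} (u v : List (Fin (n - 1))) : Prop :=
  ∃ (a b : List (Fin (n - 1))) (i j : Fin (n - 1)),
    1 < |((i : ℕ) : ℤ) - ((j : ℕ) : ℤ)| ∧ u = a ++ i :: j :: b ∧ v = a ++ j :: i :: b

/-- All reduced words of `w` form a single commutation class. -/
def IsFullyCommutative {n : ℕ} (w : Equiv.Perm (Fin n)) : Prop :=
  ∀ u ∈ reducedWords w, ∀ v ∈ reducedWords w, Relation.ReflTransGen CommutationMove u v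

/-- The (strong) Bruhat order: the reflexive transitive closure of `u < u t`, for `t` a
transposition with `ℓ(u) < ℓ(u t)`. -/
def BruhatLE {n : ℕ} : Equiv.Perm (Fin n) → Equiv.Perm (Fin n) → Prop :=
  Relation.ReflTransGen fun u v =>
    ∃ a b : Fin n, a ≠ b ∧ v = u * Equiv.swap a b ∧ length u < length v

/-- The principal order ideal of `w` in the Bruhat order is isomorphic to a (finite) boolean
algebra, that is, to the lattice of all subsets of a `k`-element set for some `k`. -/
def IsBoolean {n : ℕ} (w : Equiv.Perm (Fin n)) : Prop :=
  ∃ k : ℕ, Nonempty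
    ((fun u v : {u : Equiv.Perm (Fin n) // BruhatLE u w} => BruhatLE u.1 v.1) ≃r
      (fun A B : Finset (Fin k) => A ⊆ B))

/-- `c` is a (right) boolean core of `w`: it is boolean, it has the same support as `w`, and
`w = c w'` is a length-additive factorization. -/
def IsBooleanCore {n : ℕ} (c w : Equiv.Perm (Fin n)) : Prop :=
  IsBoolean c ∧ supp c = supp w ∧
    ∃ w' : Equiv.Perm (Fin n), w = c * w' ∧ length w = length c + length w'

/-- The one-line notation `w(1) w(2) ⋯ w(n)`. -/
def oneLine {n : ℕ} (w : Equiv.Perm (Fin n)) : List ℕ :=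
  List.ofFn fun i => (w i : ℕ) + 1

/-- Row insertion of `x` into an increasing row: `x` replaces the leftmost entry larger than `x`,
which is returned as the bumped entry; if there is none, `x` is put at the end of the row. -/
def rowInsert : List ℕ → ℕ → List ℕ × Option ℕ
  | [], x => ([x], none)
  | a :: r, x => if x < a then (x :: r, some a) else (a :: (rowInsert r x).1, (rowInsert r x).2)

/-- Schensted insertion of `x` into a tableau, given as the list of its rows from top to bottom:
an entry bumped from a row is inserted into the next row. -/
def tableauInsert : List (List ℕ) → ℕ → List (List ℕ)
  | [], x => [[x]]
  | r :: T, x =>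
    match rowInsert r x with
    | (r', none) => r' :: T
    | (r', some z) => r' :: tableauInsert T z

/-- The insertion tableau `P(w)`, as the list of its rows from top to bottom. -/
def insertionTableau {n : ℕ} (w : Equiv.Perm (Fin n)) : List (List ℕ) :=
  (oneLine w).foldl tableauInsert []

/-- The set of entries in the second row of a tableau (empty if there is no second row). -/
def rowTwo (T : List (List ℕ)) : Set ℤ :=
  {z | ∃ q ∈ T.getD 1 [], (q : ℤ) = z}

/-- `|[y, y + 2x] ∩ L| ≤ x + 1` for all integers `x`, `y` with `x > 0`. -/
def IsUncrowdedSet (L : Set ℤ) : Prop :=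
  ∀ x y : ℤ, 0 < x → ((Set.Icc y (y + 2 * x) ∩ L).ncard : ℤ) ≤ x + 1

/-- A tableau with at most two rows is uncrowded if its second row is an uncrowded set. -/
def IsUncrowdedTableau (T : List (List ℕ)) : Prop :=
  T.length ≤ 2 ∧ IsUncrowdedSet (rowTwo T)

/-- A permutation is uncrowded if its insertion tableau is uncrowded. -/
def IsUncrowded {n : ℕ} (w : Equiv.Perm (Fin n)) : Prop :=
  IsUncrowdedTableau (insertionTableau w)

end FCPerm

/-!
A fully commutative permutation avoids `321`, so each of its inversions pairs a lower entry with an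
upper one. From a reduced word with a repeated letter one letter can be commuted to the right, out
of the prefix holding the distinct letters seen so far; iterating gives a reduced word whose prefix
without repetitions uses every letter, and this prefix spells a boolean core. The inversions of any
core are the innermost inversions of `w`, which makes the core unique.

Row insertion of a `321`-avoiding permutation produces a stable matching of its inversions: an
upper entry is matched with the lower entry which bumps it into the second row. Hence the second row
of `P(w)` holds the upper entries matched by a stable matching of all inversions, that of `P(ŵ)`
those matched by a stable matching of the innermost ones. The latter always form a subset, which is
everything when the second row of `P(w)` is uncrowded; and as at most two matched pairs cross any
given cut in a boolean permutation, the second row of `P(ŵ)` is always uncrowded.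
-/

namespace FCPerm

variable {n : ℕ}

/-! ### Words and the exchange property -/

/-- The left one of the two positions exchanged by the simple reflection with letter `i`. -/
abbrev leftPos (i : Fin (n - 1)) : Fin n := ⟨i, by omega⟩

/-- The right one of the two positions exchanged by the simple reflection with letter `i`. -/
abbrev rightPos (i : Fin (n - 1)) : Fin n := ⟨i + 1, by omega⟩

lemma leftPos_lt_rightPos (i : Fin (n - 1)) : leftPos i < rightPos i :=
  Fin.mk_lt_mk.2 (Nat.lt_succ_self i)

lemma simpleReflection_eq_swap (i : Fin (n - 1)) :
    simpleReflection i = Equiv.swap (leftPos i) (rightPos i) := rfl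

@[simp] lemma simpleReflection_mul_self (i : Fin (n - 1)) :
    simpleReflection i * simpleReflection i = 1 := Equiv.swap_mul_self _ _

@[simp] lemma simpleReflection_mul_cancel_left (i : Fin (n - 1)) (w : Equiv.Perm (Fin n)) :
    simpleReflection i * (simpleReflection i * w) = w := by
  rw [← mul_assoc, simpleReflection_mul_self, one_mul]

@[simp] lemma simpleReflection_apply_self (i : Fin (n - 1)) (x : Fin n) :
    simpleReflection i (simpleReflection i x) = x := by
  rw [← Equiv.Perm.mul_apply, simpleReflection_mul_self, Equiv.Perm.one_apply]

lemma eq_of_simpleReflection_lt {i : Fin (n - 1)} {x y : Fin n} (hxy : x < y)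
    (h : simpleReflection i y < simpleReflection i x) : x = leftPos i ∧ y = rightPos i := by
  simp only [simpleReflection, Equiv.swap_apply_def, Fin.ext_iff] at h
  simp only [Fin.ext_iff]
  rw [Fin.lt_def] at hxy
  split_ifs at h <;> rw [Fin.lt_def] at h <;> grind

lemma simpleReflection_lt {i : Fin (n - 1)} {x y : Fin n} (hxy : x < y)
    (h : ¬ (x = leftPos i ∧ y = rightPos i)) : simpleReflection i x < simpleReflection i y :=
  lt_of_le_of_ne (not_lt.1 fun hyx => h (eq_of_simpleReflection_lt hxy hyx))
    ((simpleReflection i).injective.ne hxy.ne)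

@[simp] lemma wordProd_nil : wordProd ([] : List (Fin (n - 1))) = 1 := rfl

@[simp] lemma wordProd_cons (i : Fin (n - 1)) (u : List (Fin (n - 1))) :
    wordProd (i :: u) = simpleReflection i * wordProd u := List.prod_cons

@[simp] lemma wordProd_append (u v : List (Fin (n - 1))) :
    wordProd (u ++ v) = wordProd u * wordProd v := by
  rw [wordProd, List.map_append, List.prod_append, wordProd, wordProd]

lemma wordProd_surjective : Function.Surjective (wordProd : List (Fin (n - 1)) → _) := by
  intro w
  rcases n with _ | n
  · exact ⟨[], Subsingleton.elim _ _⟩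
  have hw : w ∈ Submonoid.closure (Set.range fun i : Fin n => Equiv.swap i.castSucc i.succ) :=
    Equiv.Perm.mclosure_swap_castSucc_succ n ▸ Submonoid.mem_top w
  induction hw using Submonoid.closure_induction with
  | mem x hx =>
    obtain ⟨i, rfl⟩ := hx
    exact ⟨[i], mul_one _⟩
  | one => exact ⟨[], rfl⟩
  | mul x y _ _ hx hy =>
    obtain ⟨u, rfl⟩ := hx
    obtain ⟨v, rfl⟩ := hy
    exact ⟨u ++ v, wordProd_append u v⟩

/-- The word `u` is reduced: no shorter word spells the same permutation. -/
def IsReduced (u : List (Fin (n - 1))) : Prop := length (wordProd u) = u.length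

lemma length_wordProd_le (u : List (Fin (n - 1))) : length (wordProd u) ≤ u.length :=
  Nat.sInf_le ⟨u, rfl, rfl⟩

lemma exists_isReduced (w : Equiv.Perm (Fin n)) : ∃ u, wordProd u = w ∧ IsReduced u := by
  obtain ⟨u, rfl⟩ := wordProd_surjective w
  obtain ⟨v, hlen, hv⟩ := Nat.sInf_mem
    (s := {k | ∃ v : List (Fin (n - 1)), v.length = k ∧ wordProd v = wordProd u}) ⟨_, u, rfl, rfl⟩
  exact ⟨v, hv, by rw [IsReduced, hv, hlen, length]⟩

lemma mem_reducedWords_iff {u : List (Fin (n - 1))} {w : Equiv.Perm (Fin n)} :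
    u ∈ reducedWords w ↔ wordProd u = w ∧ IsReduced u :=
  and_congr_right fun h => h ▸ eq_comm

lemma length_mul_le (u v : Equiv.Perm (Fin n)) : length (u * v) ≤ length u + length v := by
  obtain ⟨x, rfl, hx⟩ := exists_isReduced u
  obtain ⟨y, rfl, hy⟩ := exists_isReduced v
  rw [hx, hy, ← wordProd_append, ← List.length_append]
  exact length_wordProd_le _

lemma IsReduced.left_right {u v : List (Fin (n - 1))} (h : IsReduced (u ++ v)) :
    IsReduced u ∧ IsReduced v := by
  have hu := length_wordProd_le u
  have hv := length_wordProd_le v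
  have huv := length_mul_le (wordProd u) (wordProd v)
  rw [← wordProd_append, h, List.length_append] at huv
  exact ⟨by rw [IsReduced]; omega, by rw [IsReduced]; omega⟩

lemma IsReduced.of_wordProd_eq {u v : List (Fin (n - 1))} (hv : IsReduced v)
    (h : wordProd u = wordProd v) (hlen : u.length = v.length) : IsReduced u := by
  rw [IsReduced, h, hv, hlen]

lemma exists_wordProd_eq_mul_swap {a b : Fin n} (hab : a < b) : ∀ u : List (Fin (n - 1)),
    wordProd u b < wordProd u a →
    ∃ x i y, u = x ++ i :: y ∧ wordProd (x ++ y) = wordProd u * Equiv.swap a b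
  | [], h => absurd h hab.not_gt
  | j :: u, h => by
    rw [wordProd_cons] at h
    rcases lt_or_ge (wordProd u b) (wordProd u a) with hu | hu
    · obtain ⟨x, i, y, rfl, hxy⟩ := exists_wordProd_eq_mul_swap hab u hu
      exact ⟨j :: x, i, y, rfl,
        by rw [List.cons_append, wordProd_cons, hxy, wordProd_cons, mul_assoc]⟩
    · obtain ⟨ha, hb⟩ :=
        eq_of_simpleReflection_lt (hu.lt_of_ne ((wordProd u).injective.ne hab.ne)) h
      have hj : simpleReflection j = Equiv.swap (wordProd u a) (wordProd u b) := by rw [ha, hb]; rfl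
      refine ⟨[], j, u, rfl, ?_⟩
      rw [wordProd_cons, hj, ← Equiv.mul_swap_eq_swap_mul, List.nil_append, mul_assoc,
        Equiv.swap_mul_self, mul_one]

lemma length_mul_swap_lt {w : Equiv.Perm (Fin n)} {a b : Fin n} (hab : a < b)
    (h : w b < w a) : length (w * Equiv.swap a b) < length w := by
  obtain ⟨u, rfl, hu⟩ := exists_isReduced w
  obtain ⟨x, i, y, rfl, hxy⟩ := exists_wordProd_eq_mul_swap hab u h
  rw [← hxy, hu]
  refine (length_wordProd_le _).trans_lt ?_
  simp only [List.length_append, List.length_cons]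
  omega

lemma length_lt_mul_swap_iff {w : Equiv.Perm (Fin n)} {a b : Fin n} (hab : a < b) :
    length w < length (w * Equiv.swap a b) ↔ w a < w b := by
  constructor
  · exact fun h => lt_of_le_of_ne (not_lt.1 fun hba => (length_mul_swap_lt hab hba).not_gt h)
      (w.injective.ne hab.ne)
  · intro h
    simpa [mul_assoc] using length_mul_swap_lt (w := w * Equiv.swap a b) hab (by simpa using h)

lemma length_mul_simpleReflection_of_descent {w : Equiv.Perm (Fin n)} {i : Fin (n - 1)}
    (h : w (rightPos i) < w (leftPos i)) : length (w * simpleReflection i) + 1 = length w := by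
  have hlt : length (w * simpleReflection i) < length w :=
    length_mul_swap_lt (leftPos_lt_rightPos i) h
  have hle := length_mul_le (w * simpleReflection i) (simpleReflection i)
  have hone : length (simpleReflection i) ≤ 1 := by simpa using length_wordProd_le [i]
  rw [mul_assoc, simpleReflection_mul_self, mul_one] at hle
  omega

/-! ### The Bruhat order -/

lemma bruhatLE_refl (w : Equiv.Perm (Fin n)) : BruhatLE w w := Relation.ReflTransGen.refl

lemma BruhatLE.trans {u v w : Equiv.Perm (Fin n)} (huv : BruhatLE u v) (hvw : BruhatLE v w) :
    BruhatLE u w := Relation.ReflTransGen.trans huv hvw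

lemma exists_lt_of_bruhat_step {u v : Equiv.Perm (Fin n)}
    (h : ∃ a b : Fin n, a ≠ b ∧ v = u * Equiv.swap a b ∧ length u < length v) :
    ∃ a b : Fin n, a < b ∧ u a < u b ∧ v = u * Equiv.swap a b := by
  obtain ⟨a, b, hne, rfl, hlen⟩ := h
  rcases lt_or_gt_of_ne hne with hab | hba
  · exact ⟨a, b, hab, (length_lt_mul_swap_iff hab).1 hlen, rfl⟩
  · rw [Equiv.swap_comm] at hlen ⊢
    exact ⟨b, a, hba, (length_lt_mul_swap_iff hba).1 hlen, rfl⟩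

lemma bruhatLE_deletion {x y : List (Fin (n - 1))} {i : Fin (n - 1)}
    (hxy : IsReduced (x ++ y)) (h : IsReduced (x ++ i :: y)) :
    BruhatLE (wordProd (x ++ y)) (wordProd (x ++ i :: y)) := by
  refine Relation.ReflTransGen.single
    ⟨(wordProd y)⁻¹ (leftPos i), (wordProd y)⁻¹ (rightPos i), ?_, ?_, ?_⟩
  · exact (wordProd y)⁻¹.injective.ne (leftPos_lt_rightPos i).ne
  · rw [Equiv.swap_apply_apply]
    simp [simpleReflection, mul_assoc]
  · rw [hxy, h]
    simp

lemma IsReduced.bruhatLE_append {u v : List (Fin (n - 1))} (h : IsReduced (u ++ v)) :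
    BruhatLE (wordProd u) (wordProd (u ++ v)) := by
  induction v generalizing u with
  | nil => exact (List.append_nil u).symm ▸ bruhatLE_refl _
  | cons i v ih =>
    rw [List.append_cons] at h ⊢
    have hui := h.left_right.1
    have hstep := bruhatLE_deletion (y := []) (by simpa using hui.left_right.1) hui
    exact BruhatLE.trans (by simpa using hstep) (ih h)

lemma one_bruhatLE (w : Equiv.Perm (Fin n)) : BruhatLE 1 w := by
  obtain ⟨u, rfl, hu⟩ := exists_isReduced w
  exact IsReduced.bruhatLE_append (u := []) hu

lemma exists_sublist_of_bruhatLE {u : List (Fin (n - 1))} {v : Equiv.Perm (Fin n)}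
    (h : BruhatLE v (wordProd u)) : ∃ x : List (Fin (n - 1)), x.Sublist u ∧ wordProd x = v := by
  induction h using Relation.ReflTransGen.head_induction_on with
  | refl => exact ⟨u, .refl u, rfl⟩
  | head hstep _ ih =>
    obtain ⟨x, hx, rfl⟩ := ih
    obtain ⟨a, b, hab, hlt, hswap⟩ := exists_lt_of_bruhat_step hstep
    obtain ⟨y, i, z, rfl, hyz⟩ :=
      exists_wordProd_eq_mul_swap hab x (by rw [hswap]; simpa using hlt)
    refine ⟨y ++ z, .trans (by simp) hx, ?_⟩
    rw [hyz, hswap, mul_assoc, Equiv.swap_mul_self, mul_one]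


/-! ### Preserved cuts and supports -/

/-- `w` permutes the first `m` points among themselves. -/
def PreservesCut (m : ℕ) (w : Equiv.Perm (Fin n)) : Prop :=
  ∀ a : Fin n, (w a : ℕ) < m ↔ (a : ℕ) < m

lemma preservesCut_one (m : ℕ) : PreservesCut m (1 : Equiv.Perm (Fin n)) := fun _ => Iff.rfl

lemma PreservesCut.mul {m : ℕ} {u v : Equiv.Perm (Fin n)} (hu : PreservesCut m u)
    (hv : PreservesCut m v) : PreservesCut m (u * v) := fun a => (hu (v a)).trans (hv a)

lemma PreservesCut.inv {m : ℕ} {w : Equiv.Perm (Fin n)} (hw : PreservesCut m w) :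
    PreservesCut m w⁻¹ := fun a => by rw [← hw (w⁻¹ a), ← Equiv.Perm.mul_apply, mul_inv_cancel,
    Equiv.Perm.one_apply]

lemma preservesCut_simpleReflection {m : ℕ} {i : Fin (n - 1)} (h : m ≠ i + 1) :
    PreservesCut m (simpleReflection i) := by
  intro a
  simp only [simpleReflection, Equiv.swap_apply_def]
  split_ifs <;> simp_all only [Fin.ext_iff] <;> omega

lemma not_preservesCut_simpleReflection (i : Fin (n - 1)) :
    ¬ PreservesCut (i + 1) (simpleReflection i) :=
  fun h => by simpa [simpleReflection] using h (leftPos i)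

lemma preservesCut_wordProd {m : ℕ} {u : List (Fin (n - 1))} (h : ∀ i ∈ u, m ≠ i + 1) :
    PreservesCut m (wordProd u) := by
  induction u with
  | nil => exact preservesCut_one m
  | cons i u ih =>
    rw [List.forall_mem_cons] at h
    exact wordProd_cons i u ▸ (preservesCut_simpleReflection h.1).mul (ih h.2)

lemma preservesCut_wordProd_of_notMem {i : Fin (n - 1)} {u : List (Fin (n - 1))} (h : i ∉ u) :
    PreservesCut (i + 1) (wordProd u) :=
  preservesCut_wordProd fun _ hj hij => h (Fin.ext (Nat.succ_injective hij) ▸ hj)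

lemma PreservesCut.of_bruhatLE {m : ℕ} {u v : Equiv.Perm (Fin n)} (huv : BruhatLE u v)
    (hv : PreservesCut m v) : PreservesCut m u := by
  induction huv with
  | refl => exact hv
  | tail _ hstep ih =>
    obtain ⟨a, b, hab, hlt, rfl⟩ := exists_lt_of_bruhat_step hstep
    refine ih fun x => ?_
    have ha := hv a
    have hb := hv b
    have hx := hv x
    simp only [Equiv.Perm.mul_apply, Equiv.swap_apply_left, Equiv.swap_apply_right] at ha hb hx
    rw [Fin.lt_def] at hab hlt
    rcases eq_or_ne x a with rfl | hxa
    · omega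
    rcases eq_or_ne x b with rfl | hxb
    · omega
    rwa [Equiv.swap_apply_of_ne_of_ne hxa hxb] at hx

lemma IsReduced.mem_iff {u : List (Fin (n - 1))} (hu : IsReduced u) {i : Fin (n - 1)} :
    i ∈ u ↔ ¬ PreservesCut (i + 1) (wordProd u) := by
  refine ⟨fun hi hcut => ?_, not_imp_comm.1 preservesCut_wordProd_of_notMem⟩
  obtain ⟨x, y, rfl, hx⟩ := List.eq_append_cons_of_mem hi
  rw [List.append_cons] at hu hcut
  have hxi := hcut.of_bruhatLE hu.bruhatLE_append
  apply not_preservesCut_simpleReflection i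
  simpa using (preservesCut_wordProd_of_notMem hx).inv.mul hxi

lemma mem_supp_iff {w : Equiv.Perm (Fin n)} {i : Fin (n - 1)} :
    i ∈ supp w ↔ ¬ PreservesCut (i + 1) w := by
  constructor
  · rintro ⟨u, hmem, hi⟩
    obtain ⟨rfl, hu⟩ := mem_reducedWords_iff.1 hmem
    exact hu.mem_iff.1 hi
  · obtain ⟨u, rfl, hu⟩ := exists_isReduced w
    exact fun h => ⟨u, mem_reducedWords_iff.2 ⟨rfl, hu⟩, hu.mem_iff.2 h⟩

lemma IsReduced.mem_supp_iff {u : List (Fin (n - 1))} (hu : IsReduced u) {i : Fin (n - 1)} :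
    i ∈ supp (wordProd u) ↔ i ∈ u := by
  rw [hu.mem_iff, FCPerm.mem_supp_iff]

lemma supp_subset_of_bruhatLE {u v : Equiv.Perm (Fin n)} (huv : BruhatLE u v) :
    supp u ⊆ supp v := fun i hi => by
  rw [mem_supp_iff] at hi ⊢
  exact fun hv => hi (hv.of_bruhatLE huv)

/-! ### Boolean permutations -/

lemma not_preservesCut_append_cons {x y : List (Fin (n - 1))} {i : Fin (n - 1)} (hx : i ∉ x)
    (hy : i ∉ y) : ¬ PreservesCut (i + 1) (wordProd (x ++ i :: y)) := fun h => by
  have hi := ((preservesCut_wordProd_of_notMem hx).inv.mul h).mul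
    (preservesCut_wordProd_of_notMem hy).inv
  apply not_preservesCut_simpleReflection i
  simpa [mul_assoc] using hi

lemma notMem_of_nodup_append_cons {α : Type*} {x y : List α} {a : α} (h : (x ++ a :: y).Nodup) :
    a ∉ x ∧ a ∉ y :=
  ⟨fun ha => (List.nodup_append.1 h).2.2 a ha a List.mem_cons_self rfl,
    (List.nodup_cons.1 (List.nodup_append.1 h).2.1).1⟩

lemma supp_wordProd_of_nodup {u : List (Fin (n - 1))} (hu : u.Nodup) {i : Fin (n - 1)} :
    i ∈ supp (wordProd u) ↔ i ∈ u := by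
  rw [mem_supp_iff]
  refine ⟨not_imp_comm.1 preservesCut_wordProd_of_notMem, fun hi => ?_⟩
  obtain ⟨x, y, rfl⟩ := List.append_of_mem hi
  obtain ⟨hx, hy⟩ := notMem_of_nodup_append_cons hu
  exact not_preservesCut_append_cons hx hy

lemma isReduced_of_nodup {u : List (Fin (n - 1))} (hu : u.Nodup) : IsReduced u := by
  obtain ⟨v, hvu, hv⟩ := exists_isReduced (wordProd u)
  have hsub : u ⊆ v := fun i hi => by
    rwa [← hv.mem_supp_iff, hvu, supp_wordProd_of_nodup hu]
  refine (length_wordProd_le u).antisymm ?_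
  rw [← hvu, hv]
  exact (hu.subperm hsub).length_le

lemma bruhatLE_of_sublist {u v : List (Fin (n - 1))} (huv : u.Sublist v) (hv : v.Nodup) :
    BruhatLE (wordProd u) (wordProd v) := by
  suffices h : ∀ x : List (Fin (n - 1)), (x ++ v).Nodup →
      BruhatLE (wordProd (x ++ u)) (wordProd (x ++ v)) from h [] hv
  clear hv
  induction huv with
  | slnil => exact fun x _ => bruhatLE_refl _
  | cons i _ ih =>
    intro x hx
    have hdel := hx.sublist ((List.sublist_cons_self i _).append_left x)
    exact (ih x hdel).trans (bruhatLE_deletion (isReduced_of_nodup hdel) (isReduced_of_nodup hx))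
  | cons_cons i _ ih =>
    intro x hx
    simpa using ih (x ++ [i]) (by simpa using hx)

lemma filter_mem_eq_of_sublist {α : Type*} [DecidableEq α] {x u : List α} (hxu : x.Sublist u)
    (hu : u.Nodup) : u.filter (· ∈ x) = x := by
  have hsub : x.Sublist (u.filter (· ∈ x)) := by
    simpa [List.filter_eq_self.2] using hxu.filter (· ∈ x)
  refine (hsub.eq_of_length (List.Perm.length_eq ?_)).symm
  rw [List.perm_ext_iff_of_nodup (hu.sublist hxu) (hu.filter _)]
  exact fun a => ⟨fun ha => hsub.subset ha, fun ha => by simpa using (List.mem_filter.1 ha).2⟩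

/-- An isomorphism from the principal order ideal of `w` in the Bruhat order onto the boolean
algebra of rank `k`. -/
abbrev BooleanIdealIso (w : Equiv.Perm (Fin n)) (k : ℕ) : Type :=
  (fun u v : {u : Equiv.Perm (Fin n) // BruhatLE u w} => BruhatLE u.1 v.1) ≃r
    (fun A B : Finset (Fin k) => A ⊆ B)

/-- The subword of `u` at the positions in `A`. -/
def subword (u : List (Fin (n - 1))) (A : Finset (Fin u.length)) : List (Fin (n - 1)) :=
  u.filter fun i => ∃ j ∈ A, u.get j = i

lemma subword_sublist (u : List (Fin (n - 1))) (A : Finset (Fin u.length)) :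
    (subword u A).Sublist u := List.filter_sublist

lemma get_mem_subword_iff {u : List (Fin (n - 1))} (hu : u.Nodup) {A : Finset (Fin u.length)}
    {j : Fin u.length} : u.get j ∈ subword u A ↔ j ∈ A := by
  simp [subword, List.mem_filter, hu.get_inj_iff, List.get_mem, -List.get_eq_getElem]

lemma exists_subword_eq {u x : List (Fin (n - 1))} (hu : u.Nodup) (hxu : x.Sublist u) :
    ∃ A, subword u A = x := by
  refine ⟨Finset.univ.filter fun j => u.get j ∈ x, .trans ?_ (filter_mem_eq_of_sublist hxu hu)⟩
  refine List.filter_congr fun i hi => ?_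
  obtain ⟨j, rfl⟩ := List.mem_iff_get.1 hi
  simp [hu.get_inj_iff, -List.get_eq_getElem]

lemma bruhatLE_subword_iff {u : List (Fin (n - 1))} (hu : u.Nodup)
    {A B : Finset (Fin u.length)} :
    BruhatLE (wordProd (subword u A)) (wordProd (subword u B)) ↔ A ⊆ B := by
  have hnodup (C) : (subword u C).Nodup := hu.sublist (subword_sublist u C)
  constructor
  · intro h j hj
    have hsupp := supp_subset_of_bruhatLE h
      ((supp_wordProd_of_nodup (hnodup A)).2 ((get_mem_subword_iff hu).2 hj))
    exact (get_mem_subword_iff hu).1 ((supp_wordProd_of_nodup (hnodup B)).1 hsupp)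
  · intro h
    refine bruhatLE_of_sublist (List.monotone_filter_right _ fun i hi => ?_) (hnodup B)
    simp only [decide_eq_true_eq] at hi ⊢
    exact hi.imp fun j hj => ⟨h hj.1, hj.2⟩

lemma isBoolean_of_nodup {u : List (Fin (n - 1))} (hu : u.Nodup) : IsBoolean (wordProd u) := by
  let f (A : Finset (Fin u.length)) : {v // BruhatLE v (wordProd u)} :=
    ⟨wordProd (subword u A), bruhatLE_of_sublist (subword_sublist u A) hu⟩
  have hf (A B) : BruhatLE (f A).1 (f B).1 ↔ A ⊆ B := bruhatLE_subword_iff hu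
  have hinj : Function.Injective f := fun A B hAB =>
    ((hf A B).1 (hAB ▸ bruhatLE_refl _)).antisymm ((hf B A).1 (hAB ▸ bruhatLE_refl _))
  refine ⟨u.length, ⟨(RelIso.ofSurjective ⟨⟨f, hinj⟩, hf _ _⟩ ?_).symm⟩⟩
  rintro ⟨v, hv⟩
  obtain ⟨x, hx, rfl⟩ := exists_sublist_of_bruhatLE hv
  obtain ⟨A, rfl⟩ := exists_subword_eq hu hx
  exact ⟨A, rfl⟩

lemma exists_bruhatLE_length_add_one {v : Equiv.Perm (Fin n)} (hv : v ≠ 1) :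
    ∃ u, BruhatLE u v ∧ length u + 1 = length v := by
  obtain ⟨x, rfl, hx⟩ := exists_isReduced v
  rcases x.eq_nil_or_concat with rfl | ⟨x, i, rfl⟩
  · exact absurd wordProd_nil hv
  · rw [List.concat_eq_append] at hx ⊢
    refine ⟨wordProd x, hx.bruhatLE_append, ?_⟩
    rw [hx, hx.left_right.1, List.length_append, List.length_singleton]

lemma exists_simpleReflection_bruhatLE {v : Equiv.Perm (Fin n)} (hv : v ≠ 1) :
    ∃ i, BruhatLE (simpleReflection i) v := by
  obtain ⟨x, rfl, hx⟩ := exists_isReduced v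
  rcases x with _ | ⟨i, x⟩
  · exact absurd wordProd_nil hv
  · exact ⟨i, by simpa using IsReduced.bruhatLE_append (u := [i]) hx⟩

lemma simpleReflection_ne_one (i : Fin (n - 1)) : simpleReflection i ≠ 1 := fun h =>
  not_preservesCut_simpleReflection i (h ▸ preservesCut_one _)

section BooleanIdealIso

variable {w : Equiv.Perm (Fin n)} {k : ℕ} (e : BooleanIdealIso w k)

include e

lemma BooleanIdealIso.length_le_card (v : {v // BruhatLE v w}) : length v.1 ≤ (e v).card := by
  induction hm : length v.1 using Nat.strong_induction_on generalizing v with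
  | _ m ih =>
    subst hm
    rcases eq_or_ne v.1 1 with hv | hv
    · rw [hv]
      exact (length_wordProd_le []).trans (Nat.zero_le _)
    · obtain ⟨u, huv, hlen⟩ := exists_bruhatLE_length_add_one hv
      let u' : {v // BruhatLE v w} := ⟨u, huv.trans v.2⟩
      have hne : e u' ≠ e v := fun h => by
        have huv' : u = v.1 := congrArg Subtype.val (e.injective h)
        rw [huv'] at hlen
        omega
      have hlt := Finset.card_lt_card ((e.map_rel_iff.2 huv : e u' ⊆ e v).ssubset_of_ne hne)
      have hle := ih (length u) (by omega) u' rfl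
      omega

lemma BooleanIdealIso.eq_one_iff (v : {v // BruhatLE v w}) : v.1 = 1 ↔ e v = ∅ := by
  have hbot : e ⟨1, one_bruhatLE w⟩ = ∅ := by
    have h : e ⟨1, one_bruhatLE w⟩ ⊆ e (e.symm ∅) := e.map_rel_iff.2 (one_bruhatLE _)
    rwa [e.apply_symm_apply, Finset.subset_empty] at h
  rw [← hbot, e.injective.eq_iff, Subtype.ext_iff]

lemma BooleanIdealIso.exists_simpleReflection_eq_symm_singleton (j : Fin k) :
    ∃ i ∈ supp w, simpleReflection i = (e.symm {j}).1 := by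
  have hatom : (e.symm {j}).1 ≠ 1 := by
    rw [Ne, e.eq_one_iff, e.apply_symm_apply]
    exact Finset.singleton_ne_empty j
  obtain ⟨i, hi⟩ := exists_simpleReflection_bruhatLE hatom
  let s : {v // BruhatLE v w} := ⟨simpleReflection i, hi.trans (e.symm {j}).2⟩
  have hs : e s ⊆ {j} := e.apply_symm_apply {j} ▸ e.map_rel_iff.2 hi
  rcases Finset.subset_singleton_iff.1 hs with h | h
  · exact absurd ((e.eq_one_iff s).2 h) (simpleReflection_ne_one i)
  · refine ⟨i, supp_subset_of_bruhatLE s.2 ?_, by rw [← h, e.symm_apply_apply]⟩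
    exact mem_supp_iff.2 (not_preservesCut_simpleReflection i)

end BooleanIdealIso

lemma IsReduced.nodup_of_isBoolean {u : List (Fin (n - 1))} (hu : IsReduced u)
    (h : IsBoolean (wordProd u)) : u.Nodup := by
  classical
  obtain ⟨k, ⟨(e : BooleanIdealIso (wordProd u) k)⟩⟩ := h
  have hlen : u.length ≤ k := by
    have hle := e.length_le_card ⟨wordProd u, bruhatLE_refl _⟩
    rw [hu] at hle
    exact hle.trans ((Finset.card_le_univ _).trans_eq (Fintype.card_fin k))
  choose f hf hfe using e.exists_simpleReflection_eq_symm_singleton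
  have hinj : Function.Injective f := fun j j' hj => by
    have hsymm : e.symm {j} = e.symm {j'} := Subtype.ext (by rw [← hfe, ← hfe, hj])
    exact Finset.singleton_injective (e.symm.injective hsymm)
  have hsub : List.ofFn f ⊆ u := fun i hi => by
    obtain ⟨j, rfl⟩ := List.mem_ofFn.1 hi
    exact hu.mem_supp_iff.1 (hf j)
  have hsubperm := (List.nodup_ofFn.2 hinj).subperm hsub
  exact (hsubperm.perm_of_length_le (by simpa using hlen)).nodup_iff.1 (List.nodup_ofFn.2 hinj)

/-! ### Fully commutative permutations avoid `321` -/

/-- Two letters are neighbours: the simple reflections do not commute and satisfy the braid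
relation. -/
def Adj (i j : Fin (n - 1)) : Prop := (i : ℕ) + 1 = j ∨ (j : ℕ) + 1 = i

lemma Adj.ne {i j : Fin (n - 1)} (h : Adj i j) : i ≠ j := by
  rintro rfl
  simp [Adj] at h

lemma commute_simpleReflection {i j : Fin (n - 1)} (hij : i ≠ j) (h : ¬ Adj i j) :
    Commute (simpleReflection i) (simpleReflection j) := by
  rw [Ne, Fin.ext_iff] at hij
  unfold Adj at h
  apply Equiv.Perm.Disjoint.commute
  intro x
  simp only [simpleReflection, Equiv.swap_apply_def, Fin.ext_iff]
  split_ifs <;> grind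

lemma commute_simpleReflection_wordProd {i : Fin (n - 1)} {u : List (Fin (n - 1))} (hi : i ∉ u)
    (h : ∀ j ∈ u, ¬ Adj i j) : Commute (simpleReflection i) (wordProd u) := by
  refine Commute.list_prod_right _ _ fun s hs => ?_
  obtain ⟨j, hj, rfl⟩ := List.mem_map.1 hs
  exact commute_simpleReflection (fun hij => hi (hij ▸ hj)) (h j hj)

lemma simpleReflection_braid {i j : Fin (n - 1)} (h : Adj i j) :
    simpleReflection i * simpleReflection j * simpleReflection i =
      simpleReflection j * simpleReflection i * simpleReflection j := by
  wlog hij : (i : ℕ) + 1 = j generalizing i j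
  · exact (this h.symm (h.resolve_left hij)).symm
  have hmid : rightPos i = leftPos j := Fin.ext hij
  have hi := (leftPos_lt_rightPos i).ne
  have hj := (leftPos_lt_rightPos j).ne
  have hne : leftPos i ≠ rightPos j := ((leftPos_lt_rightPos i).trans
    (hmid ▸ leftPos_lt_rightPos j)).ne
  rw [simpleReflection_eq_swap, simpleReflection_eq_swap j, ← hmid]
  rw [← hmid] at hj
  rw [Equiv.swap_mul_swap_mul_swap hi hne, Equiv.swap_comm (leftPos i),
    Equiv.swap_comm _ (rightPos j), Equiv.swap_mul_swap_mul_swap hj.symm hne.symm, Equiv.swap_comm]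

/-- No reduced word of `w` has a factor `i j i` with `i` and `j` neighbours. -/
def BraidFree (w : Equiv.Perm (Fin n)) : Prop :=
  ∀ (x y : List (Fin (n - 1))) (i j : Fin (n - 1)), Adj i j →
    wordProd (x ++ i :: j :: i :: y) = w → ¬ IsReduced (x ++ i :: j :: i :: y)

lemma CommutationMove.perm {u v : List (Fin (n - 1))} (h : CommutationMove u v) : u.Perm v := by
  obtain ⟨a, b, i, j, _, rfl, rfl⟩ := h
  exact (List.Perm.swap _ _ _).append_left _

lemma perm_of_reflTransGen_commutationMove {u v : List (Fin (n - 1))}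
    (h : Relation.ReflTransGen CommutationMove u v) : u.Perm v := by
  induction h with
  | refl => rfl
  | tail _ hmove ih => exact ih.trans hmove.perm

lemma IsFullyCommutative.braidFree {w : Equiv.Perm (Fin n)} (hw : IsFullyCommutative w) :
    BraidFree w := by
  rintro x y i j hij rfl hu
  have hbraid : wordProd (x ++ j :: i :: j :: y) = wordProd (x ++ i :: j :: i :: y) := by
    simpa [mul_assoc] using
      congrArg (fun g => wordProd x * (g * wordProd y)) (simpleReflection_braid hij).symm
  have hperm := perm_of_reflTransGen_commutationMove <|
    hw _ (mem_reducedWords_iff.2 ⟨rfl, hu⟩) _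
      (mem_reducedWords_iff.2 ⟨hbraid, hu.of_wordProd_eq hbraid (by simp)⟩)
  simpa [List.count_append, hij.ne.symm] using hperm.count_eq i

lemma BraidFree.of_append {x y : List (Fin (n - 1))} (h : BraidFree (wordProd (x ++ y)))
    (hxy : IsReduced (x ++ y)) : BraidFree (wordProd x) := by
  intro a b i j hij hx hred
  have hspell : wordProd (a ++ i :: j :: i :: (b ++ y)) = wordProd (x ++ y) := by
    rw [wordProd_append x y, ← hx]
    simp [mul_assoc]
  have hlen : (a ++ i :: j :: i :: b).length = x.length := by
    rw [← hred, hx, hxy.left_right.1]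
  refine h a (b ++ y) i j hij hspell (hxy.of_wordProd_eq hspell ?_)
  simp only [List.length_append, List.length_cons] at hlen ⊢
  omega

lemma exists_isReduced_concat_of_descent {w : Equiv.Perm (Fin n)} {i : Fin (n - 1)}
    (h : w (rightPos i) < w (leftPos i)) :
    ∃ u, wordProd u = w * simpleReflection i ∧ wordProd (u ++ [i]) = w ∧ IsReduced (u ++ [i]) := by
  obtain ⟨u, hu, hred⟩ := exists_isReduced (w * simpleReflection i)
  have hw : wordProd (u ++ [i]) = w := by simp [hu, mul_assoc]
  refine ⟨u, hu, hw, ?_⟩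
  rw [IsReduced, hw, ← length_mul_simpleReflection_of_descent h, ← hu, hred, List.length_append,
    List.length_singleton]

lemma BraidFree.of_descent {w : Equiv.Perm (Fin n)} (hw : BraidFree w) {i : Fin (n - 1)}
    (h : w (rightPos i) < w (leftPos i)) : BraidFree (w * simpleReflection i) := by
  obtain ⟨u, hu, rfl, hred⟩ := exists_isReduced_concat_of_descent h
  exact hu ▸ hw.of_append hred

lemma BraidFree.not_consecutive_descents {w : Equiv.Perm (Fin n)} (hw : BraidFree w)
    {i j : Fin (n - 1)} (hij : rightPos i = leftPos j) (hi : w (rightPos i) < w (leftPos i)) :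
    ¬ w (rightPos j) < w (leftPos j) := by
  intro hj
  have hne : leftPos i ≠ rightPos j :=
    ((leftPos_lt_rightPos i).trans (hij ▸ leftPos_lt_rightPos j)).ne
  have hri : rightPos i ≠ rightPos j := hij ▸ (leftPos_lt_rightPos j).ne
  have hli := (leftPos_lt_rightPos i).ne
  have hsj : simpleReflection j = Equiv.swap (rightPos i) (rightPos j) := by rw [hij]; rfl
  rw [← hij] at hj
  have hlen := length_mul_simpleReflection_of_descent hi
  have hlen' := length_mul_simpleReflection_of_descent (w := w * simpleReflection i) (i := j) <| by
    rw [← hij]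
    simpa [simpleReflection_eq_swap i, Equiv.swap_apply_of_ne_of_ne hne.symm hri.symm]
      using hj.trans hi
  obtain ⟨u, hu, hspell, hred⟩ := exists_isReduced_concat_of_descent
      (w := w * simpleReflection i * simpleReflection j) (i := i) <| by
    rw [hsj]
    simpa [simpleReflection_eq_swap i, Equiv.swap_apply_of_ne_of_ne hne.symm hri.symm,
      Equiv.swap_apply_of_ne_of_ne hli hne] using hj
  have hw' : wordProd (u ++ [i, j, i]) = w := by simp [hu, mul_assoc]
  refine hw u [] i j (.inl (Fin.ext_iff.1 hij)) hw' ?_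
  rw [IsReduced, hspell, List.length_append, List.length_singleton] at hred
  rw [IsReduced, hw']
  simp only [List.length_append, List.length_cons, List.length_nil]
  omega

/-- `w` avoids the pattern `321`. -/
def Avoids321 (w : Equiv.Perm (Fin n)) : Prop :=
  ∀ ⦃a b c : Fin n⦄, a < b → b < c → w b < w a → ¬ w c < w b

lemma exists_descent {w : Equiv.Perm (Fin n)} {a b : Fin n} (hab : a < b) (h : w b < w a) :
    ∃ i : Fin (n - 1), a ≤ leftPos i ∧ rightPos i ≤ b ∧ w (rightPos i) < w (leftPos i) := by
  by_contra! hasc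
  have hmono : MonotoneOn w (Set.Icc a b) :=
    monotoneOn_of_le_succ Set.ordConnected_Icc fun x hmax hx hsucc => by
      have hcov : (x : ℕ) + 1 = Order.succ x :=
        Nat.covBy_iff_add_one_eq.1 (Fin.covBy_iff.1 (Order.covBy_succ_of_not_isMax hmax))
      have hright : rightPos ⟨x, by omega⟩ = Order.succ x := Fin.ext hcov
      exact hright ▸ hasc ⟨x, by omega⟩ hx.1 (hright ▸ hsucc.2)
  exact (hmono (Set.left_mem_Icc.2 hab.le) (Set.right_mem_Icc.2 hab.le) hab.le).not_gt h

lemma BraidFree.avoids321 {w : Equiv.Perm (Fin n)} (hw : BraidFree w) : Avoids321 w := by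
  induction hm : length w using Nat.strong_induction_on generalizing w with
  | _ m ih =>
    subst hm
    intro a b c hab hbc hba hcb
    have hdescent {i : Fin (n - 1)} (hi : w (rightPos i) < w (leftPos i)) :
        (a = leftPos i ∧ b = rightPos i) ∨ (b = leftPos i ∧ c = rightPos i) := by
      by_contra! hne
      have hlen := length_mul_simpleReflection_of_descent hi
      exact ih _ (by omega) (hw.of_descent hi) rfl
        (simpleReflection_lt hab fun h => hne.1 h.1 h.2)
        (simpleReflection_lt hbc fun h => hne.2 h.1 h.2) (by simpa) (by simpa)
    obtain ⟨i, _, hib, hi⟩ := exists_descent hab hba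
    obtain ⟨j, hbj, _, hj⟩ := exists_descent hbc hcb
    have hbi : b = rightPos i := ((hdescent hi).resolve_right fun h =>
      hib.not_gt (h.1 ▸ leftPos_lt_rightPos i)).2
    have hbj' : b = leftPos j := ((hdescent hj).resolve_left fun h =>
      hbj.not_gt (h.2 ▸ leftPos_lt_rightPos j)).1
    exact hw.not_consecutive_descents (hbi.symm.trans hbj') hi hj

/-! ### Existence of the boolean core -/

lemma exists_eq_append_of_not_nodup {α : Type*} : ∀ {u : List α}, ¬ u.Nodup →
    ∃ z i x y, u = z ++ i :: (x ++ i :: y) ∧ (x ++ i :: y).Nodup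
  | [], h => absurd List.nodup_nil h
  | a :: u, h => by
    by_cases hu : u.Nodup
    · have ha : a ∈ u := by_contra fun ha => h (List.nodup_cons.2 ⟨ha, hu⟩)
      obtain ⟨x, y, rfl⟩ := List.append_of_mem ha
      exact ⟨[], a, x, y, rfl, hu⟩
    · obtain ⟨z, i, x, y, rfl, hxy⟩ := exists_eq_append_of_not_nodup hu
      exact ⟨a :: z, i, x, y, rfl, hxy⟩

lemma IsReduced.exists_adj {z x v : List (Fin (n - 1))} {i : Fin (n - 1)}
    (h : IsReduced (z ++ i :: (x ++ i :: v))) (hi : i ∉ x) : ∃ q ∈ x, Adj i q := by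
  by_contra! hx
  have hspell : wordProd (z ++ i :: (x ++ i :: v)) = wordProd (z ++ (x ++ v)) := by
    simp only [wordProd_append, wordProd_cons]
    rw [← mul_assoc (wordProd x), ← (commute_simpleReflection_wordProd hi hx).eq, mul_assoc,
      simpleReflection_mul_cancel_left]
  have hle := length_wordProd_le (z ++ (x ++ v))
  rw [← hspell, h] at hle
  simp at hle

lemma BraidFree.exists_two_adj {z x v : List (Fin (n - 1))} {i : Fin (n - 1)}
    (hw : BraidFree (wordProd (z ++ i :: (x ++ i :: v))))
    (h : IsReduced (z ++ i :: (x ++ i :: v))) (hi : i ∉ x) (hx : x.Nodup) :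
    ∃ q ∈ x, ∃ q' ∈ x, q ≠ q' ∧ Adj i q ∧ Adj i q' := by
  obtain ⟨q, hq, hiq⟩ := h.exists_adj hi
  by_contra! hone
  obtain ⟨α, β, rfl⟩ := List.append_of_mem hq
  obtain ⟨hqα, hqβ⟩ := notMem_of_nodup_append_cons hx
  have hcomm {γ} (hγ : γ ⊆ α ++ q :: β) (hqγ : q ∉ γ) :
      Commute (simpleReflection i) (wordProd γ) :=
    commute_simpleReflection_wordProd (fun hiγ => hi (hγ hiγ)) fun j hj =>
      hone q hq j (hγ hj) (fun hqj => hqγ (hqj ▸ hj)) hiq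
  have hα := hcomm (by simp) hqα
  have hβ := hcomm (by simp) hqβ
  have hspell : wordProd ((z ++ α) ++ i :: q :: i :: (β ++ v)) =
      wordProd (z ++ i :: ((α ++ q :: β) ++ i :: v)) := by
    simp only [wordProd_append, wordProd_cons, mul_assoc]
    rw [← mul_assoc (wordProd α), ← hα.eq, ← mul_assoc (simpleReflection i) (wordProd β), hβ.eq]
    simp only [mul_assoc]
  refine hw (z ++ α) (β ++ v) i q hiq hspell (h.of_wordProd_eq hspell ?_)
  simp only [List.length_append, List.length_cons]
  omega

lemma commute_of_two_adj {i q q' : Fin (n - 1)} {y : List (Fin (n - 1))} (hne : q ≠ q')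
    (hq : Adj i q) (hq' : Adj i q') (hi : i ∉ y) (hqy : q ∉ y) (hqy' : q' ∉ y) :
    Commute (simpleReflection i) (wordProd y) := by
  refine commute_simpleReflection_wordProd hi fun j hj hij => ?_
  have hj' : j = q ∨ j = q' := by
    simp only [Adj, Fin.ext_iff, ne_eq] at *
    omega
  rcases hj' with rfl | rfl
  · exact hqy hj
  · exact hqy' hj

lemma BraidFree.exists_nodup_prefix (u v : List (Fin (n - 1)))
    (hw : BraidFree (wordProd (u ++ v))) (hred : IsReduced (u ++ v)) :
    ∃ u' v', wordProd (u' ++ v') = wordProd (u ++ v) ∧ IsReduced (u' ++ v') ∧ u'.Nodup ∧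
      ∀ i, i ∈ u' ↔ i ∈ u := by
  induction hm : u.length using Nat.strong_induction_on generalizing u v with
  | _ m ih =>
    by_cases hu : u.Nodup
    · exact ⟨u, v, rfl, hred, hu, fun _ => Iff.rfl⟩
    obtain ⟨z, i, x, y, rfl, hxy⟩ := exists_eq_append_of_not_nodup hu
    obtain ⟨hix, hiy⟩ := notMem_of_nodup_append_cons hxy
    have hdisj {q} (hq : q ∈ x) : q ∉ y := fun hqy =>
      (List.nodup_append.1 hxy).2.2 q hq q (List.mem_cons_of_mem i hqy) rfl
    have hassoc : z ++ i :: (x ++ i :: y) ++ v = z ++ i :: (x ++ i :: (y ++ v)) := by simp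
    obtain ⟨q, hq, q', hq', hne, hiq, hiq'⟩ := (hassoc ▸ hw).exists_two_adj (hassoc ▸ hred) hix
      (List.nodup_append.1 hxy).1
    have hcomm := commute_of_two_adj hne hiq hiq' hiy (hdisj hq) (hdisj hq')
    have hspell : wordProd (z ++ i :: (x ++ y) ++ i :: v) =
        wordProd (z ++ i :: (x ++ i :: y) ++ v) := by
      simp only [wordProd_append, wordProd_cons, mul_assoc]
      rw [← mul_assoc (wordProd y), ← hcomm.eq, mul_assoc]
    obtain ⟨u', v', huv', hred', hu', hmem⟩ := ih (z ++ i :: (x ++ y)).length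
      (by simp [← hm]) _ _ (hspell ▸ hw)
      (hred.of_wordProd_eq hspell (by simp; omega)) rfl
    refine ⟨u', v', huv'.trans hspell, hred', hu', fun j => ?_⟩
    rw [hmem]
    simp only [List.mem_append, List.mem_cons]
    tauto

lemma BraidFree.exists_isBooleanCore {w : Equiv.Perm (Fin n)} (hw : BraidFree w) :
    ∃ c, IsBooleanCore c w := by
  obtain ⟨u, rfl, hu⟩ := exists_isReduced w
  obtain ⟨x, y, hxy, hred, hx, hmem⟩ := exists_nodup_prefix u [] (by simpa) (by simpa)
  rw [List.append_nil] at hxy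
  obtain ⟨hxred, hyred⟩ := hred.left_right
  refine ⟨wordProd x, isBoolean_of_nodup hx, ?_, wordProd y, ?_, ?_⟩
  · ext i
    rw [hxred.mem_supp_iff, hu.mem_supp_iff, hmem]
  · rw [← wordProd_append, hxy]
  · rw [hxred, hyred, ← hxy, hred, List.length_append]

/-! ### Inversions and the uniqueness of the boolean core -/

/-- The values `b < t` form an inversion of `w`: `t` stands to the left of `b`. -/
def IsInversion (w : Equiv.Perm (Fin n)) (b t : ℕ) : Prop :=
  ∃ i j : Fin n, i < j ∧ w j < w i ∧ (w j : ℕ) = b ∧ (w i : ℕ) = t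

lemma IsInversion.lt {w : Equiv.Perm (Fin n)} {b t : ℕ} (h : IsInversion w b t) : b < t := by
  obtain ⟨i, j, _, hji, rfl, rfl⟩ := h
  exact hji

lemma IsInversion.mul_simpleReflection {w : Equiv.Perm (Fin n)} {i : Fin (n - 1)}
    (hasc : w (leftPos i) < w (rightPos i)) {b t : ℕ} (h : IsInversion w b t) :
    IsInversion (w * simpleReflection i) b t := by
  obtain ⟨p, q, hpq, hlt, hb, ht⟩ := h
  have hne : ¬ (p = leftPos i ∧ q = rightPos i) := by
    rintro ⟨rfl, rfl⟩
    exact lt_asymm hasc hlt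
  exact ⟨_, _, simpleReflection_lt hpq hne, by simpa, by simpa, by simpa⟩

lemma IsInversion.append {x y : List (Fin (n - 1))} (hred : IsReduced (x ++ y)) {b t : ℕ}
    (h : IsInversion (wordProd x) b t) : IsInversion (wordProd (x ++ y)) b t := by
  induction y generalizing x with
  | nil => rwa [List.append_nil]
  | cons i y ih =>
    rw [List.append_cons] at hred ⊢
    have hxi := hred.left_right.1
    have hspell : wordProd (x ++ [i]) = wordProd x * simpleReflection i := by simp
    have hlen : length (wordProd x) < length (wordProd x * simpleReflection i) := by
      rw [← hspell, hxi, hxi.left_right.1, List.length_append]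
      exact Nat.lt_succ_self _
    refine ih hred (hspell ▸ h.mul_simpleReflection ?_)
    exact (length_lt_mul_swap_iff (leftPos_lt_rightPos i)).1 hlen

lemma IsInversion.mul {c v : Equiv.Perm (Fin n)} (hlen : length (c * v) = length c + length v)
    {b t : ℕ} (h : IsInversion c b t) : IsInversion (c * v) b t := by
  obtain ⟨x, rfl, hx⟩ := exists_isReduced c
  obtain ⟨y, rfl, hy⟩ := exists_isReduced v
  rw [← wordProd_append] at hlen ⊢
  exact h.append (by rw [IsReduced, hlen, List.length_append, hx, hy])

lemma isInversion_iff_inv_lt {w : Equiv.Perm (Fin n)} {x y : Fin n} (hxy : x < y) :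
    IsInversion w x y ↔ w⁻¹ y < w⁻¹ x := by
  constructor
  · rintro ⟨i, j, hij, _, hj, hi⟩
    obtain rfl := Fin.ext hj
    obtain rfl := Fin.ext hi
    simpa
  · exact fun h => ⟨_, _, h, by simpa, by simp, by simp⟩

lemma isInversion_injective : Function.Injective (IsInversion (n := n)) := by
  intro v w h
  have hinv {x y : Fin n} (hxy : x < y) : v⁻¹ y < v⁻¹ x ↔ w⁻¹ y < w⁻¹ x := by
    rw [← isInversion_iff_inv_lt hxy, h, isInversion_iff_inv_lt hxy]
  have hlt {x y : Fin n} (hxy : v⁻¹ x < v⁻¹ y) : w⁻¹ x < w⁻¹ y := by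
    rcases lt_trichotomy x y with hlt | rfl | hgt
    · exact lt_of_le_of_ne (not_lt.1 fun hyx => hxy.not_gt ((hinv hlt).2 hyx))
        (w⁻¹.injective.ne hlt.ne)
    · exact absurd hxy (lt_irrefl _)
    · exact (hinv hgt).1 hxy
  have hmono : StrictMono (w⁻¹ * v) := fun x y hxy => hlt (by simpa)
  have hid : ⇑(w⁻¹ * v) = id := (hmono.range_inj strictMono_id).1 (by simp)
  exact (inv_mul_eq_one.1 (DFunLike.coe_injective hid)).symm

/-- An abstraction of the inversion relation of a `321`-avoiding permutation. An entry cannot be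
both lower and upper, and the entries between those of a pair are related to one of the two.
By `fill`, a lower entry `b'` and an upper entry `t'` inside a pair are themselves related. -/
structure IsInversionRel (E : ℕ → ℕ → Prop) : Prop where
  lt {b t : ℕ} : E b t → b < t
  not_both {b t u : ℕ} : E b t → ¬ E t u
  between {b t x : ℕ} : E b t → b < x → x < t → E b x ∨ E x t
  fill {b t b' t' u v : ℕ} : E b t → E b' u → E v t' → b ≤ b' → t' ≤ t → b' < t' → E b' t'

/-- Some pair of `R` is separated by the cut between `m - 1` and `m`. -/
def Crosses (R : ℕ → ℕ → Prop) (m : ℕ) : Prop := ∃ b t, R b t ∧ b < m ∧ m ≤ t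

lemma crosses_isInversion_iff {w : Equiv.Perm (Fin n)} {m : ℕ} :
    Crosses (IsInversion w) m ↔ ¬ PreservesCut m w := by
  constructor
  · rintro ⟨_, _, ⟨i, j, hij, _, rfl, rfl⟩, hj, hi⟩ hcut
    rw [hcut] at hj
    rw [← not_lt, hcut] at hi
    exact hi (lt_trans hij hj)
  · intro hcut
    have hup : ∃ a : Fin n, (a : ℕ) < m ∧ m ≤ w a := by
      by_contra! h
      have hinv := Equiv.Perm.perm_symm_mapsTo_of_mapsTo w (s := {a : Fin n | (a : ℕ) < m}) h
      exact hcut fun a => ⟨fun ha => by simpa using hinv ha, h a⟩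
    have hdown : ∃ a : Fin n, m ≤ (a : ℕ) ∧ (w a : ℕ) < m := by
      by_contra! h
      have hinv := Equiv.Perm.perm_symm_mapsTo_of_mapsTo w (s := {a : Fin n | m ≤ (a : ℕ)}) h
      exact hcut fun a => not_iff_not.1 (by simpa using ⟨fun ha => by simpa using hinv ha, h a⟩)
    obtain ⟨i, hi, hwi⟩ := hup
    obtain ⟨j, hj, hwj⟩ := hdown
    exact ⟨w j, w i, ⟨i, j, hi.trans_le hj, hwj.trans_le hwi, rfl, rfl⟩, hwj, hwi⟩

/-- No pair of `R` is properly enclosed in another one. -/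
def NestingFree (R : ℕ → ℕ → Prop) : Prop :=
  ∀ ⦃b t b' t'⦄, R b t → b < b' → t' < t → ¬ R b' t'

/-- The pairs of `E` which do not properly enclose a pair of `E`. -/
def Innermost (E : ℕ → ℕ → Prop) (b t : ℕ) : Prop :=
  E b t ∧ ∀ b' t', b < b' → t' < t → ¬ E b' t'

section CrossingSubrelation

variable {E F : ℕ → ℕ → Prop} (hE : IsInversionRel E) (hF : IsInversionRel F) (hFE : F ≤ E)
  (hcross : ∀ m, Crosses E m → Crosses F m)

include hE hF hFE hcross

lemma exists_upper_of_crosses {b t : ℕ} (h : E b t) : ∃ t, F b t := by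
  obtain ⟨b', t', hF', hb, ht⟩ := hcross (b + 1) ⟨b, t, h, b.lt_succ_self, hE.lt h⟩
  rcases (Nat.lt_succ_iff.1 hb).eq_or_lt with rfl | hlt
  · exact ⟨t', hF'⟩
  · rcases hF.between hF' hlt ht with h' | h'
    · exact absurd h (hE.not_both (hFE _ _ h'))
    · exact ⟨t', h'⟩

lemma exists_lower_of_crosses {b t : ℕ} (h : E b t) : ∃ b, F b t := by
  obtain ⟨b', t', hF', hb, ht⟩ := hcross t ⟨b, t, h, hE.lt h, le_rfl⟩
  rcases ht.eq_or_lt with rfl | hlt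
  · exact ⟨b', hF'⟩
  · rcases hF.between hF' hb hlt with h' | h'
    · exact ⟨b', h'⟩
    · exact absurd (hFE _ _ h') (hE.not_both h)

lemma le_innermost_of_nestingFree (hnest : NestingFree F) : F ≤ Innermost E := by
  refine fun b t h => ⟨hFE b t h, fun b' t' hb ht h' => ?_⟩
  obtain ⟨u, hu⟩ := exists_upper_of_crosses hE hF hFE hcross h'
  obtain ⟨v, hv⟩ := exists_lower_of_crosses hE hF hFE hcross h'
  exact hnest h hb ht (hF.fill h hu hv hb.le ht.le (hE.lt h'))

lemma innermost_le_of_crosses : Innermost E ≤ F := by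
  classical
  rintro b t ⟨h, hmin⟩
  by_contra hbt
  have hlt {x : ℕ} (hx : F b x) : x < t := by
    obtain ⟨v, hv⟩ := exists_lower_of_crosses hE hF hFE hcross h
    exact not_le.1 fun htx => hbt (hF.fill hx hx hv le_rfl htx (hE.lt h))
  -- The largest partner `s` of `b` in `F` is less than `t`; a pair of `F` crossing the cut above
  -- `s` yields a pair of `E` enclosed in `(b, t)`.
  obtain ⟨s, hs, hmax⟩ : ∃ s, F b s ∧ ∀ x, F b x → x ≤ s := by
    obtain ⟨u, hu⟩ := exists_upper_of_crosses hE hF hFE hcross h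
    exact ⟨Nat.findGreatest (F b) t, Nat.findGreatest_spec (hlt hu).le hu,
      fun x hx => Nat.le_findGreatest (hlt hx).le hx⟩
  have hbs := hF.lt hs
  obtain ⟨b', t', h', hb', ht'⟩ := hcross (s + 1) ⟨b, t, h, by omega, hlt hs⟩
  have hbb' : b < b' := by
    by_contra! hle
    have hle' := hmax _ (hF.fill h' hs h' hle le_rfl (by omega))
    omega
  rcases lt_or_ge t' t with htt' | -
  · exact hmin _ _ hbb' htt' (hFE _ _ h')
  · have hne : b' ≠ s := fun heq => hF.not_both hs (heq ▸ h')
    exact hmin _ _ hbb' (hlt hs)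
      (hE.fill h (hFE _ _ h') (hFE _ _ hs) hbb'.le (hlt hs).le (by omega))

end CrossingSubrelation

lemma Avoids321.lt_of_upper_lt {w : Equiv.Perm (Fin n)} (hw : Avoids321 w) {i j k : Fin n}
    (hij : i < j) (hji : w j < w i) (hik : w i < w k) : i < k :=
  lt_of_le_of_ne (not_lt.1 fun hki => hw hki hij hik hji) fun h => (h ▸ hik).ne rfl

lemma Avoids321.lt_of_lt_lower {w : Equiv.Perm (Fin n)} (hw : Avoids321 w) {i j k : Fin n}
    (hij : i < j) (hji : w j < w i) (hkj : w k < w j) : k < j :=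
  lt_of_le_of_ne (not_lt.1 fun hjk => hw hij hjk hji hkj) fun h => (h ▸ hkj).ne rfl

lemma Avoids321.isInversionRel {w : Equiv.Perm (Fin n)} (hw : Avoids321 w) :
    IsInversionRel (IsInversion w) where
  lt := IsInversion.lt
  not_both := by
    rintro b t u ⟨i, j, hij, hji, rfl, rfl⟩ ⟨k, l, hkl, hlk, hl, rfl⟩
    obtain rfl := w.injective (Fin.ext hl)
    exact hw hkl hij hlk hji
  between := by
    rintro b t x ⟨i, j, hij, _, rfl, rfl⟩ hbx hxt
    obtain ⟨k, hk⟩ := w.surjective ⟨x, hxt.trans (w i).2⟩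
    obtain rfl : (w k : ℕ) = x := Fin.ext_iff.1 hk
    rcases lt_or_ge k j with hkj | hjk
    · exact .inl ⟨k, j, hkj, hbx, rfl, rfl⟩
    · exact .inr ⟨i, k, hij.trans_le hjk, hxt, rfl, rfl⟩
  fill := by
    rintro b t b' t' u v ⟨i, j, hij, _, rfl, rfl⟩ ⟨p, q, hpq, hqp, rfl, rfl⟩
      ⟨r, s, hrs, hsr, rfl, rfl⟩ hb ht hlt
    have hri : r ≤ i := ht.eq_or_lt.elim (fun h => (w.injective (Fin.ext h)).le)
      fun h => (hw.lt_of_upper_lt hrs hsr h).le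
    have hjq : j ≤ q := hb.eq_or_lt.elim (fun h => (w.injective (Fin.ext h)).le)
      fun h => (hw.lt_of_lt_lower hpq hqp h).le
    exact ⟨r, q, hri.trans_lt (hij.trans_le hjq), hlt, rfl, rfl⟩

/-- At most one value of `c` goes up, and at most one goes down, across each cut. -/
structure ThinCuts (c : Equiv.Perm (Fin n)) : Prop where
  up (m : ℕ) {a b : Fin n} : (a : ℕ) < m → m ≤ c a → (b : ℕ) < m → m ≤ c b → a = b
  down (m : ℕ) {a b : Fin n} : m ≤ (a : ℕ) → (c a : ℕ) < m → m ≤ (b : ℕ) → (c b : ℕ) < m → a = b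

lemma preservesCut_or_exists_eq_mul {u : List (Fin (n - 1))} (hu : u.Nodup) (m : ℕ) :
    PreservesCut m (wordProd u) ∨ ∃ (i : Fin (n - 1)) (x y : Equiv.Perm (Fin n)), m = i + 1 ∧
      wordProd u = x * (simpleReflection i * y) ∧ PreservesCut m x ∧ PreservesCut m y := by
  by_cases hm : ∃ i ∈ u, m = (i : ℕ) + 1
  · obtain ⟨i, hi, rfl⟩ := hm
    obtain ⟨x, y, rfl⟩ := List.append_of_mem hi
    obtain ⟨hx, hy⟩ := notMem_of_nodup_append_cons hu
    exact .inr ⟨i, wordProd x, wordProd y, rfl, by simp, preservesCut_wordProd_of_notMem hx,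
      preservesCut_wordProd_of_notMem hy⟩
  · push Not at hm
    exact .inl (preservesCut_wordProd hm)

lemma eq_leftPos_of_crosses_up {i : Fin (n - 1)} {z : Fin n} (hz : (z : ℕ) < i + 1)
    (h : (i : ℕ) + 1 ≤ simpleReflection i z) : z = leftPos i := by
  simp only [simpleReflection, Equiv.swap_apply_def, Fin.ext_iff] at h ⊢
  split_ifs at h <;> grind

lemma eq_rightPos_of_crosses_down {i : Fin (n - 1)} {z : Fin n} (hz : (i : ℕ) + 1 ≤ z)
    (h : (simpleReflection i z : ℕ) < i + 1) : z = rightPos i := by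
  simp only [simpleReflection, Equiv.swap_apply_def, Fin.ext_iff] at h ⊢
  split_ifs at h <;> grind

lemma thinCuts_of_nodup {u : List (Fin (n - 1))} (hu : u.Nodup) : ThinCuts (wordProd u) where
  up m a b ha hca hb hcb := by
    rcases preservesCut_or_exists_eq_mul hu m with h | ⟨i, x, y, rfl, hxy, hx, hy⟩
    · exact absurd ((h a).2 ha) hca.not_gt
    · rw [hxy, Equiv.Perm.mul_apply, ← not_lt, hx, not_lt] at hca hcb
      exact y.injective ((eq_leftPos_of_crosses_up ((hy a).2 ha) hca).trans
        (eq_leftPos_of_crosses_up ((hy b).2 hb) hcb).symm)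
  down m a b ha hca hb hcb := by
    rcases preservesCut_or_exists_eq_mul hu m with h | ⟨i, x, y, rfl, hxy, hx, hy⟩
    · exact absurd ((h a).1 hca) ha.not_gt
    · rw [hxy, Equiv.Perm.mul_apply, hx] at hca hcb
      rw [← not_lt, ← hy, not_lt] at ha hb
      exact y.injective ((eq_rightPos_of_crosses_down ha hca).trans
        (eq_rightPos_of_crosses_down hb hcb).symm)

lemma IsBoolean.thinCuts {c : Equiv.Perm (Fin n)} (h : IsBoolean c) : ThinCuts c := by
  obtain ⟨u, rfl, hu⟩ := exists_isReduced c
  exact thinCuts_of_nodup (hu.nodup_of_isBoolean h)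

lemma ThinCuts.nestingFree {c : Equiv.Perm (Fin n)} (hthin : ThinCuts c) (hc : Avoids321 c) :
    NestingFree (IsInversion c) := by
  rintro _ _ _ _ ⟨i, j, hij, _, rfl, rfl⟩ hb ht ⟨i', j', hij', hji', rfl, rfl⟩
  have hii' := hc.lt_of_upper_lt hij' hji' ht
  have hjj' := hc.lt_of_lt_lower hij' hji' hb
  rw [Fin.lt_def] at *
  rcases lt_or_ge (i : ℕ) (c i') with hi | hi
  · exact hii'.ne' (congrArg _ (hthin.up (c i') hi (by omega) (by omega) le_rfl))
  · exact hjj'.ne (congrArg _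
      (hthin.down (c i') (a := j) (b := j') (by omega) (by omega) (by omega) (by omega)))

lemma IsBooleanCore.isInversion_le {c w : Equiv.Perm (Fin n)} (h : IsBooleanCore c w) :
    IsInversion c ≤ IsInversion w := by
  obtain ⟨_, _, v, rfl, hlen⟩ := h
  exact fun b t => IsInversion.mul hlen

lemma IsBooleanCore.avoids321 {c w : Equiv.Perm (Fin n)} (h : IsBooleanCore c w)
    (hw : Avoids321 w) : Avoids321 c := fun i j k hij hjk hji hkj =>
  hw.isInversionRel.not_both (h.isInversion_le _ _ ⟨j, k, hjk, hkj, rfl, rfl⟩)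
    (h.isInversion_le _ _ ⟨i, j, hij, hji, rfl, rfl⟩)

lemma IsBooleanCore.isInversion_eq_innermost {c w : Equiv.Perm (Fin n)} (h : IsBooleanCore c w)
    (hw : Avoids321 w) : IsInversion c = Innermost (IsInversion w) := by
  have hc := h.avoids321 hw
  have hcross (m : ℕ) : Crosses (IsInversion w) m → Crosses (IsInversion c) m := by
    rintro ⟨_, _, ⟨i, j, hij, hji, rfl, rfl⟩, hj, hi⟩
    have hsupp := Set.ext_iff.1 h.2.1 ⟨m - 1, by omega⟩
    simp only [mem_supp_iff, ← crosses_isInversion_iff] at hsupp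
    rw [Nat.sub_add_cancel (Nat.one_le_of_lt hj)] at hsupp
    exact hsupp.2 ⟨w j, w i, ⟨i, j, hij, hji, rfl, rfl⟩, hj, hi⟩
  exact le_antisymm
    (le_innermost_of_nestingFree hw.isInversionRel hc.isInversionRel h.isInversion_le hcross
      (h.1.thinCuts.nestingFree hc))
    (innermost_le_of_crosses hw.isInversionRel hc.isInversionRel h.isInversion_le hcross)

lemma IsBooleanCore.unique {c c' w : Equiv.Perm (Fin n)} (h : IsBooleanCore c w)
    (h' : IsBooleanCore c' w) (hw : Avoids321 w) : c = c' :=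
  isInversion_injective
    ((h.isInversion_eq_innermost hw).trans (h'.isInversion_eq_innermost hw).symm)


/-! ### Stable matchings -/

/-- Each pair of `E` has an entry which `M` relates to an entry at most as large as its partner in
the pair. -/
def Dominates (M E : ℕ → ℕ → Prop) : Prop :=
  ∀ ⦃b t⦄, E b t → (∃ t' ≤ t, M b t') ∨ ∃ b' ≤ b, M b' t

lemma Dominates.mono {M E F : ℕ → ℕ → Prop} (h : Dominates M E) (hFE : F ≤ E) : Dominates M F :=
  fun b t hbt => h (hFE b t hbt)

/-- `M` is a stable matching in `E`, where smaller partners are preferred. -/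
structure IsStable (E M : ℕ → ℕ → Prop) : Prop where
  le : M ≤ E
  rightUnique : Relator.RightUnique M
  leftUnique : Relator.LeftUnique M
  dominates : Dominates M E

/-- The upper entries of the pairs of `M`. -/
def tops (M : ℕ → ℕ → Prop) : Set ℕ := {t | ∃ b, M b t}

/-- No upper entry of `E` is in `[a, h)`, where `h` is `a` or `a + 1`. -/
structure FirstUpper (E : ℕ → ℕ → Prop) (a h : ℕ) : Prop where
  le : a ≤ h
  le_succ : h ≤ a + 1
  le_of_le {x t : ℕ} : E x t → a ≤ t → h ≤ t

lemma FirstUpper.refl (E : ℕ → ℕ → Prop) (a : ℕ) : FirstUpper E a a :=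
  ⟨le_rfl, a.le_succ, fun _ => id⟩

lemma IsInversionRel.firstUpper_succ {E : ℕ → ℕ → Prop} (hE : IsInversionRel E) {a s : ℕ}
    (h : E a s) : FirstUpper E a (a + 1) :=
  ⟨a.le_succ, le_rfl, fun hx hat => lt_of_le_of_ne hat fun heq => hE.not_both hx (heq ▸ h)⟩

lemma innermost_le (E : ℕ → ℕ → Prop) : Innermost E ≤ E := fun _ _ => And.left

section Pred

variable {E L : ℕ → ℕ → Prop} {a h : ℕ} (hE : IsInversionRel E) (hLE : L ≤ E)

include hE hLE

lemma exists_pred_upper (hL : Dominates L (Innermost E)) (hah : FirstUpper E a h)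
    (hLh : ∀ b', L b' h → a ≤ b') {b : ℕ} (hb : E b h) (hba : b < a) :
    ∃ c, a = c + 2 ∧ b ≤ c ∧ E b (c + 1) ∧ ∀ s, ¬ E (c + 1) s := by
  have := hah.le
  have := hah.le_succ
  have hpred : ∀ s, ¬ E (a - 1) s := by
    intro s hs
    have hpair : E (a - 1) h := hE.fill hb hs hb (by omega) le_rfl (by omega)
    have hinner : Innermost E (a - 1) h := by
      refine ⟨hpair, fun b' t' hb' ht' h' => ?_⟩
      have := hE.lt h'
      omega
    rcases hL hinner with ⟨t', ht', h'⟩ | ⟨b', hb', h'⟩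
    · have hlt := hE.lt (hLE _ _ h')
      have hle := hah.le_of_le (hLE _ _ h') (by omega)
      obtain rfl : t' = h := by omega
      have := hLh _ h'
      omega
    · have := hLh _ h'
      omega
  have hne : b ≠ a - 1 := fun heq => hpred h (heq ▸ hb)
  refine ⟨a - 2, by omega, by omega, ?_⟩
  rw [show a - 2 + 1 = a - 1 by omega]
  exact ⟨(hE.between hb (by omega) (by omega)).resolve_right (hpred _), hpred⟩

lemma matches_pred {c : ℕ} (hah : FirstUpper E (c + 2) h) (hLh : ∀ b', L b' h → c + 2 ≤ b')
    (hdom : (∃ t' ≤ h, L c t') ∨ ∃ b' ≤ c, L b' h) : L c (c + 1) := by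
  rcases hdom with ⟨t', ht', h'⟩ | ⟨b', hb', h'⟩
  · have hlt := hE.lt (hLE _ _ h')
    have hsmall : t' < c + 2 := by
      by_contra! hle
      obtain rfl : t' = h := ht'.antisymm (hah.le_of_le (hLE _ _ h') hle)
      have := hLh _ h'
      omega
    obtain rfl : t' = c + 1 := by omega
    exact h'
  · have := hLh _ h'
    omega

end Pred

lemma IsStable.mem_tops_of_lt {E M : ℕ → ℕ → Prop} (hE : IsInversionRel E) (hM : IsStable E M)
    {b t v x : ℕ} (h : M b t) (hv : E v x) (hb : b < x) (hx : x < t) : x ∈ tops M := by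
  have hbt := hM.le _ _ h
  rcases hM.dominates (hE.fill hbt hbt hv le_rfl hx.le hb) with ⟨t', ht', h'⟩ | ⟨b', _, h'⟩
  · have := hM.rightUnique h h'
    omega
  · exact ⟨b', h'⟩

/-- The condition of `IsUncrowdedSet`, for sets of natural numbers. -/
def UncrowdedNat (S : Set ℕ) : Prop := ∀ a x, 0 < x → (Set.Icc a (a + 2 * x) ∩ S).ncard ≤ x + 1

lemma ncard_Icc_succ_inter_lt {S : Set ℕ} {a k : ℕ} (ha : a ∈ S) (hak : a ≤ k) :
    (Set.Icc (a + 1) k ∩ S).ncard < (Set.Icc a k ∩ S).ncard := by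
  refine Set.ncard_lt_ncard (Set.ssubset_iff_exists.2 ⟨?_, a, ⟨⟨le_rfl, hak⟩, ha⟩, ?_⟩)
    ((Set.finite_Icc a k).inter_of_left S)
  · exact Set.inter_subset_inter_left _ (Set.Icc_subset_Icc_left a.le_succ)
  · exact fun h => a.lt_irrefl h.1.1

lemma IsStable.crosses_of_pred_mem_tops {E M : ℕ → ℕ → Prop} (hE : IsInversionRel E)
    (hM : IsStable E M) {b c t : ℕ} (hbt : M b t) (hbc : b ≤ c) (hct : c + 2 ≤ t)
    (hc : c + 1 ∈ tops M) : Crosses M c := by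
  rcases hbc.lt_or_eq with hlt | rfl
  · exact ⟨b, t, hbt, hlt, by omega⟩
  · obtain ⟨b', hb'⟩ := hc
    have hne : b' ≠ b := fun heq => by
      have := hM.rightUnique (heq ▸ hb') hbt
      omega
    have hlt := hE.lt (hM.le _ _ hb')
    exact ⟨b', b + 1, hb', by omega, b.le_succ⟩

section Compare

variable {E M N : ℕ → ℕ → Prop} (hE : IsInversionRel E) (hM : IsStable E M)
  (hN : IsStable (Innermost E) N)

include hE hM hN

lemma le_of_matches_innermost (a : ℕ) : ∀ h, FirstUpper E a h → (∀ b, M b h → a ≤ b) →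
    ∀ b, N b h → a ≤ b := by
  induction a using Nat.strong_induction_on with
  | _ a ih =>
  intro h hah hMh b hNb
  by_contra! hba
  have hbh : Innermost E b h := hN.le _ _ hNb
  have hdom := hM.dominates.mono (innermost_le E)
  obtain ⟨c, rfl, hbc, hbc', hc⟩ := exists_pred_upper hE hM.le hdom hah hMh hbh.1 hba
  have := hah.le
  have hnot {x s : ℕ} (hbx : b < x) (hxc : x ≤ c + 1) : ¬ E x s := by
    rcases hxc.lt_or_eq with hlt | rfl
    · exact fun hs => hbh.2 x (c + 1) hbx (by omega)
        (hE.fill hbh.1 hs hbc' hbx.le (by omega) hlt)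
    · exact hc s
  obtain ⟨b', hb', hNb'⟩ : ∃ b' < b, N b' (c + 1) := by
    have hinner : Innermost E b (c + 1) :=
      ⟨hbc', fun x t hx ht h' => hnot hx ((hE.lt h').trans ht).le h'⟩
    have hne : ¬ N b (c + 1) := fun h' => by
      have := hN.rightUnique h' hNb
      omega
    rcases hN.dominates hinner with ⟨t', ht', h'⟩ | ⟨b', hb', h'⟩
    · have := hN.rightUnique h' hNb
      omega
    · exact ⟨b', hb'.lt_of_ne fun heq => hne (heq ▸ h'), h'⟩
  obtain rfl : b = c := by
    by_contra hne
    refine (hN.le _ _ hNb').2 b c hb' c.lt_succ_self ?_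
    exact (hE.between hbh.1 (by omega) (by omega)).resolve_right (hnot (by omega) c.le_succ)
  have hMb : M b (b + 1) := matches_pred hE hM.le hah hMh (hM.dominates hbh.1)
  exact hb'.not_ge (ih b (by omega) (b + 1) (hE.firstUpper_succ hbh.1)
    (fun x hx => (hM.leftUnique hMb hx).le) b' hNb')

lemma tops_innermost_subset : tops N ⊆ tops M := by
  rintro k ⟨b, hb⟩
  by_contra hk
  have hle := le_of_matches_innermost hE hM hN k k (.refl E k) (fun x hx => absurd ⟨x, hx⟩ hk) b hb
  exact hle.not_gt (hE.lt (hN.le _ _ hb).1)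

lemma not_crosses_of_uncrowded (hU : UncrowdedNat (tops M)) (a : ℕ) : ∀ h j, FirstUpper E a h →
    h ∈ tops E → (∀ b, N b h → a ≤ b) → j < (Set.Icc a (a + 2 * j) ∩ tops M).ncard →
    ¬ Crosses M a := by
  induction a using Nat.strong_induction_on with
  | _ a ih =>
  rintro h j hah ⟨v, hv⟩ hNh hcount ⟨b, t, hbt, hba, hat⟩
  have hbE := hM.le _ _ hbt
  have hbh : E b h :=
    hE.fill hbE hbE hv le_rfl (hah.le_of_le hbE hat) (hba.trans_le hah.le)
  have hNE := hN.le.trans (innermost_le E)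
  obtain ⟨c, rfl, hbc, hbc', hc⟩ := exists_pred_upper hE hNE hN.dominates hah hNh hbh hba
  have := hah.le
  have := hah.le_succ
  have hctop : c + 1 ∈ tops M := hM.mem_tops_of_lt hE hbt hbc' (by omega) (by omega)
  have hcount' : j + 1 < (Set.Icc (c + 1) (c + 2 * (j + 1)) ∩ tops M).ncard := by
    rw [show c + 2 + 2 * j = c + 2 * (j + 1) by omega] at hcount
    exact (Nat.succ_le_of_lt hcount).trans_lt (ncard_Icc_succ_inter_lt hctop (by omega))
  by_cases hlow : ∃ s, E c s
  · obtain ⟨s, hs⟩ := hlow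
    have hinner : Innermost E c h := by
      refine ⟨hE.fill hbh hs hv hbc le_rfl (by omega), fun b' t' hb' ht' h' => ?_⟩
      have hlt := hE.lt h'
      obtain rfl : b' = c + 1 := by omega
      exact hc _ h'
    have hNc : N c (c + 1) := matches_pred hE hNE hah hNh (hN.dominates hinner)
    refine ih c (by omega) (c + 1) (j + 1) (hE.firstUpper_succ hs) ⟨b, hbc'⟩
      (fun x hx => (hN.leftUnique hNc hx).le) ?_
      (hM.crosses_of_pred_mem_tops hE hbt hbc hat hctop)
    exact hcount'.trans_le (Set.ncard_le_ncard (Set.inter_subset_inter_left _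
      (Set.Icc_subset_Icc_left c.le_succ)) ((Set.finite_Icc _ _).inter_of_left _))
  · push Not at hlow
    have hne : b ≠ c := fun heq => hlow _ (heq ▸ hbh)
    have hbc'' : E b c := (hE.between hbh (by omega) (by omega)).resolve_right (hlow _)
    have hctop' : c ∈ tops M := hM.mem_tops_of_lt hE hbt hbc'' (by omega) (by omega)
    have hlt := ncard_Icc_succ_inter_lt (k := c + 2 * (j + 1)) hctop' (by omega)
    have hle := hU c (j + 1) j.succ_pos
    omega

lemma tops_innermost_eq (hU : UncrowdedNat (tops M)) : tops N = tops M := by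
  refine (tops_innermost_subset hE hM hN).antisymm ?_
  rintro k ⟨b, hb⟩
  by_contra hk
  have hcount : 0 < (Set.Icc k (k + 2 * 0) ∩ tops M).ncard :=
    (Set.ncard_pos ((Set.finite_Icc _ _).inter_of_left _)).2 ⟨k, by simp, b, hb⟩
  exact not_crosses_of_uncrowded hE hM hN hU k k 0 (.refl E k) ⟨b, hM.le _ _ hb⟩
    (fun x hx => absurd ⟨x, hx⟩ hk) hcount ⟨b, k, hb, hE.lt (hM.le _ _ hb), le_rfl⟩

end Compare

/-! ### Uncrowded sets -/

lemma IsStable.uncrowdedNat_tops {E M : ℕ → ℕ → Prop} (hE : IsInversionRel E) (hM : IsStable E M)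
    (hcross : ∀ y, {t | ∃ b, M b t ∧ b < y ∧ y ≤ t}.encard ≤ 2) : UncrowdedNat (tops M) := by
  intro a x _
  set K := Set.Icc a (a + 2 * x) ∩ tops M
  have hfin : K.Finite := (Set.finite_Icc _ _).inter_of_left _
  -- Apart from at most two, the entries of `K` have distinct partners in the interval, none of them
  -- in `K`; hence `2 * K.ncard - 2 ≤ 2 * x + 1`.
  set A := {t | ∃ b, M b t ∧ b < a ∧ a ≤ t}
  have hA : (K ∩ A).ncard ≤ 2 := by
    have h := (Set.encard_le_encard (Set.inter_subset_right (s := K))).trans (hcross a)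
    rw [← (hfin.inter_of_left A).cast_ncard_eq] at h
    exact_mod_cast h
  have hpartner : ∀ t ∈ K \ A, ∃ b, M b t ∧ a ≤ b := by
    rintro t ⟨⟨⟨hat, -⟩, b, hb⟩, ht⟩
    exact ⟨b, hb, not_lt.1 fun hlt => ht ⟨b, hb, hlt, hat⟩⟩
  choose! f hf using hpartner
  have hcard : (f '' (K \ A)).ncard = (K \ A).ncard := Set.InjOn.ncard_image fun t ht t' ht' h =>
    hM.rightUnique (hf t ht).1 (h ▸ (hf t' ht').1)
  have hdisj : Disjoint K (f '' (K \ A)) := by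
    rw [Set.disjoint_left]
    rintro _ ⟨-, b, hb⟩ ⟨s, hs, rfl⟩
    exact hE.not_both (hM.le _ _ hb) (hM.le _ _ (hf s hs).1)
  have hsub : K ∪ f '' (K \ A) ⊆ Set.Icc a (a + 2 * x) := by
    refine Set.union_subset Set.inter_subset_left ?_
    rintro _ ⟨s, hs, rfl⟩
    exact ⟨(hf s hs).2, (hE.lt (hM.le _ _ (hf s hs).1)).le.trans hs.1.1.2⟩
  have hunion := Set.ncard_le_ncard hsub (Set.finite_Icc _ _)
  rw [Set.ncard_union_eq hdisj hfin (hfin.sdiff.image f), hcard, Set.ncard_Icc_nat] at hunion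
  have hsplit := Set.ncard_inter_add_ncard_sdiff_eq_ncard K A hfin
  omega

lemma ThinCuts.encard_crossing_le {c : Equiv.Perm (Fin n)} (hc : ThinCuts c) {M : ℕ → ℕ → Prop}
    (hM : IsStable (IsInversion c) M) (y : ℕ) : {t | ∃ b, M b t ∧ b < y ∧ y ≤ t}.encard ≤ 2 := by
  set U := {t | ∃ i : Fin n, (i : ℕ) < y ∧ y ≤ c i ∧ (c i : ℕ) = t}
  set D := {t | ∃ j : Fin n, y ≤ (j : ℕ) ∧ (c j : ℕ) < y ∧ M (c j) t}
  have hU : U.encard ≤ 1 := Set.encard_le_one_iff.2 <| by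
    rintro _ _ ⟨i, hi, hci, rfl⟩ ⟨j, hj, hcj, rfl⟩
    rw [hc.up y hi hci hj hcj]
  have hD : D.encard ≤ 1 := Set.encard_le_one_iff.2 <| by
    rintro t t' ⟨i, hi, hci, ht⟩ ⟨j, hj, hcj, ht'⟩
    obtain rfl := hc.down y hi hci hj hcj
    exact hM.rightUnique ht ht'
  have hsub : {t | ∃ b, M b t ∧ b < y ∧ y ≤ t} ⊆ U ∪ D := by
    rintro t ⟨b, hb, hby, hyt⟩
    obtain ⟨i, j, hij, _, rfl, rfl⟩ := hM.le _ _ hb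
    rcases lt_or_ge (j : ℕ) y with hj | hj
    · exact .inl ⟨i, lt_trans hij hj, hyt, rfl⟩
    · exact .inr ⟨j, hj, hby, hb⟩
  calc _ ≤ (U ∪ D).encard := Set.encard_le_encard hsub
    _ ≤ U.encard + D.encard := Set.encard_union_le U D
    _ ≤ 1 + 1 := add_le_add hU hD
    _ = 2 := one_add_one_eq_two

lemma isUncrowdedSet_image_iff (S : Set ℕ) :
    IsUncrowdedSet ((fun t : ℕ => (t : ℤ) + 1) '' S) ↔ UncrowdedNat S := by
  have hinj : Function.Injective fun t : ℕ => (t : ℤ) + 1 := fun s t h => by simpa using h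
  have hpreimage (y x : ℤ) : (Set.Icc y (y + 2 * x) ∩ (fun t : ℕ => (t : ℤ) + 1) '' S).ncard =
      {t ∈ S | y ≤ (t : ℤ) + 1 ∧ (t : ℤ) + 1 ≤ y + 2 * x}.ncard := by
    rw [Set.inter_comm, ← Set.image_inter_preimage, Set.ncard_image_of_injective _ hinj]
    rfl
  constructor
  · intro h a x hx
    have hle := h x (a + 1) (by omega)
    rw [hpreimage] at hle
    convert Int.ofNat_le.1 hle using 2
    ext t
    exact ⟨fun ⟨⟨hat, htx⟩, ht⟩ => ⟨ht, by omega, by omega⟩,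
      fun ⟨ht, hat, htx⟩ => ⟨⟨by omega, by omega⟩, ht⟩⟩
  · intro h x y hx
    lift x to ℕ using hx.le
    rw [hpreimage]
    refine le_trans (Nat.cast_le.2 (Set.ncard_le_ncard ?_ ((Set.finite_Icc _ _).inter_of_left _)))
      (Int.ofNat_le.2 (h (y - 1).toNat x (by omega)))
    exact fun t ⟨ht, hyt, hty⟩ => ⟨⟨by omega, by omega⟩, ht⟩

/-! ### Insertion into tableaux with at most two rows -/

lemma rowInsert_of_forall_lt {r : List ℕ} {x : ℕ} (h : ∀ a ∈ r, a < x) :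
    rowInsert r x = (r ++ [x], none) := by
  induction r with
  | nil => rfl
  | cons a r ih =>
    rw [List.forall_mem_cons] at h
    simp [rowInsert, h.1.not_gt, ih h.2]

lemma rowInsert_append_cons {l₁ l₂ : List ℕ} {x z : ℕ} (h : ∀ a ∈ l₁, a < x) (hxz : x < z) :
    rowInsert (l₁ ++ z :: l₂) x = (l₁ ++ x :: l₂, some z) := by
  induction l₁ with
  | nil => simp [rowInsert, hxz]
  | cons a l₁ ih =>
    rw [List.forall_mem_cons] at h
    simp [rowInsert, h.1.not_gt, ih h.2]

lemma forall_lt_or_exists_eq_append_cons {r : List ℕ} {x : ℕ} (hx : x ∉ r) :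
    (∀ a ∈ r, a < x) ∨ ∃ l₁ z l₂, r = l₁ ++ z :: l₂ ∧ (∀ a ∈ l₁, a < x) ∧ x < z := by
  have hlt {l : List ℕ} (hl : l ⊆ r) (h : ∀ a ∈ l, ¬ x < a) : ∀ a ∈ l, a < x :=
    fun a ha => (not_lt.1 (h a ha)).lt_of_ne fun heq => hx (heq ▸ hl ha)
  cases hfind : r.find? (x < ·) with
  | none => exact .inl (hlt (List.Subset.refl r) (by simpa using hfind))
  | some z =>
    obtain ⟨hz, l₁, l₂, rfl, hl₁⟩ := List.find?_eq_some_iff_append.1 hfind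
    exact .inr ⟨l₁, z, l₂, rfl, hlt (by simp) (by simpa using hl₁), by simpa using hz⟩

lemma pairwise_lt_replace {l₁ l₂ : List ℕ} {x z : ℕ} (hr : (l₁ ++ z :: l₂).Pairwise (· < ·))
    (h : ∀ a ∈ l₁, a < x) (hxz : x < z) : (l₁ ++ x :: l₂).Pairwise (· < ·) := by
  simp only [List.pairwise_append, List.pairwise_cons, List.forall_mem_cons] at hr ⊢
  exact ⟨hr.1, ⟨fun a ha => hxz.trans (hr.2.1.1 a ha), hr.2.1.2⟩,
    fun a ha => ⟨h a ha, (hr.2.2 a ha).2⟩⟩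

lemma le_of_mem_append_cons {l₁ l₂ : List ℕ} {x z a : ℕ} (hr : (l₁ ++ z :: l₂).Pairwise (· < ·))
    (h : ∀ a ∈ l₁, a < x) (ha : a ∈ l₁ ++ z :: l₂) (hxa : x < a) : z ≤ a := by
  rcases List.mem_append.1 ha with ha | ha
  · exact absurd hxa (h a ha).not_gt
  · rcases List.mem_cons.1 ha with rfl | ha
    · exact le_rfl
    · exact (List.rel_of_pairwise_cons (List.pairwise_append.1 hr).2.1 ha).le

lemma mem_replace_iff {l₁ l₂ : List ℕ} {x z v : ℕ} (hr : (l₁ ++ z :: l₂).Nodup) :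
    v ∈ l₁ ++ x :: l₂ ↔ v = x ∨ v ∈ l₁ ++ z :: l₂ ∧ v ≠ z := by
  have hz : z ∉ l₁ ++ l₂ := (List.nodup_middle.1 hr).notMem
  have hne : v ∈ l₁ ++ l₂ → v ≠ z := fun hv heq => hz (heq ▸ hv)
  simp only [List.mem_append, List.mem_cons] at hne ⊢
  tauto

/-- The tableau with the given rows, without its empty rows. -/
def twoRows : List ℕ → List ℕ → List (List ℕ)
  | [], _ => []
  | a :: r, [] => [a :: r]
  | a :: r, b :: s => [a :: r, b :: s]

lemma tableauInsert_twoRows_of_forall_lt {r s : List ℕ} {x : ℕ} (h : ∀ a ∈ r, a < x)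
    (hs : r = [] → s = []) : tableauInsert (twoRows r s) x = twoRows (r ++ [x]) s := by
  rcases r with _ | ⟨a, r⟩
  · rw [hs rfl]
    rfl
  · rcases s with _ | ⟨b, s⟩ <;> simp [twoRows, tableauInsert, rowInsert_of_forall_lt h]

lemma tableauInsert_twoRows_append_cons {l₁ l₂ s : List ℕ} {x z : ℕ} (h : ∀ a ∈ l₁, a < x)
    (hxz : x < z) (hs : ∀ a ∈ s, a < z) :
    tableauInsert (twoRows (l₁ ++ z :: l₂) s) x = twoRows (l₁ ++ x :: l₂) (s ++ [z]) := by
  have hins := rowInsert_append_cons (l₂ := l₂) h hxz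
  rcases l₁ with _ | ⟨a, l₁⟩ <;> rcases s with _ | ⟨b, s⟩ <;>
    simp_all [twoRows, tableauInsert, rowInsert_of_forall_lt]

lemma rowTwo_twoRows {r s : List ℕ} (hs : r = [] → s = []) :
    rowTwo (twoRows r s) = {z | ∃ q ∈ s, (q : ℤ) = z} := by
  rcases r with _ | ⟨a, r⟩
  · rw [hs rfl]
    simp [rowTwo, twoRows]
  · rcases s with _ | ⟨b, s⟩ <;> simp [rowTwo, twoRows]

lemma length_twoRows_le (r s : List ℕ) : (twoRows r s).length ≤ 2 := by
  rcases r with _ | ⟨a, r⟩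
  · simp [twoRows]
  · rcases s with _ | ⟨b, s⟩ <;> simp [twoRows]

/-! ### The matching of bumped entries -/

/-- The inversions of `w` between its first `m` positions. -/
def IsInversionBefore (m : ℕ) (w : Equiv.Perm (Fin n)) (b t : ℕ) : Prop :=
  ∃ i j : Fin n, i < j ∧ (j : ℕ) < m ∧ w j < w i ∧ (w j : ℕ) = b ∧ (w i : ℕ) = t

lemma isInversionBefore_eq_isInversion (w : Equiv.Perm (Fin n)) :
    IsInversionBefore n w = IsInversion w := by
  simp [funext_iff, IsInversionBefore, IsInversion]

lemma IsInversionBefore.isInversion {m : ℕ} {w : Equiv.Perm (Fin n)} {b t : ℕ}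
    (h : IsInversionBefore m w b t) : IsInversion w b t := by
  obtain ⟨i, j, hij, _, h⟩ := h
  exact ⟨i, j, hij, h⟩

lemma isInversionBefore_succ_iff {p : Fin n} {w : Equiv.Perm (Fin n)} {b t : ℕ} :
    IsInversionBefore (p + 1) w b t ↔
      IsInversionBefore p w b t ∨ (w p : ℕ) = b ∧ ∃ i < p, w p < w i ∧ (w i : ℕ) = t := by
  constructor
  · rintro ⟨i, j, hij, hj, hji, hb, ht⟩
    rcases (Nat.lt_succ_iff.1 hj).lt_or_eq with hj | hj
    · exact .inl ⟨i, j, hij, hj, hji, hb, ht⟩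
    · obtain rfl := Fin.ext hj
      exact .inr ⟨hb, i, hij, hji, ht⟩
  · rintro (⟨i, j, hij, hj, h⟩ | ⟨hb, i, hip, hpi, ht⟩)
    · exact ⟨i, j, hij, hj.trans p.1.lt_succ_self, h⟩
    · exact ⟨i, p, hip, p.1.lt_succ_self, hpi, hb, ht⟩

/-- The relation obtained from `M` by adding the pair `(b, t)`. -/
def adjoin (M : ℕ → ℕ → Prop) (b t : ℕ) : ℕ → ℕ → Prop := fun b' t' => M b' t' ∨ b = b' ∧ t = t'

lemma tops_adjoin (M : ℕ → ℕ → Prop) (b t : ℕ) : tops (adjoin M b t) = insert t (tops M) := by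
  ext t'
  simp [tops, adjoin, exists_or, or_comm, eq_comm]

lemma val_lt_succ_iff {i p : Fin n} : (i : ℕ) < p + 1 ↔ (i : ℕ) < p ∨ i = p := by
  rw [Nat.lt_succ_iff_lt_or_eq, Fin.ext_iff]

section Bump

variable {w : Equiv.Perm (Fin n)} {p : Fin n} {M : ℕ → ℕ → Prop}

lemma Avoids321.lower_lt (hw : Avoids321 w) {b t : ℕ} (h : IsInversionBefore p w b t) :
    b < w p := by
  obtain ⟨i, j, hij, hjp, hji, rfl, rfl⟩ := h
  by_contra! hle
  have hne : p ≠ j := fun heq => hjp.ne (by rw [heq])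
  exact lt_asymm hjp (hw.lt_of_lt_lower hij hji (lt_of_le_of_ne hle (w.injective.ne hne)))

variable (hw : Avoids321 w) (hM : IsStable (IsInversionBefore p w) M)

include hw hM

lemma IsStable.succ_of_forall_mem_tops
    (htop : ∀ i < p, w p < w i → (w i : ℕ) ∈ tops M) :
    IsStable (IsInversionBefore (p + 1) w) M where
  le b t h := isInversionBefore_succ_iff.2 (.inl (hM.le b t h))
  rightUnique := hM.rightUnique
  leftUnique := hM.leftUnique
  dominates b t h := by
    rcases isInversionBefore_succ_iff.1 h with h | ⟨rfl, i, hip, hpi, rfl⟩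
    · exact hM.dominates h
    · obtain ⟨b, hb⟩ := htop i hip hpi
      exact .inr ⟨b, (hw.lower_lt (hM.le _ _ hb)).le, hb⟩

variable {i : Fin n} (hip : i < p) (hpi : w p < w i) (hi : (w i : ℕ) ∉ tops M)

include hip hpi hi

lemma IsStable.lt_bumped {t : ℕ} (ht : t ∈ tops M) : t < w i := by
  obtain ⟨b, hb⟩ := ht
  by_contra! hle
  have hlt : (w i : ℕ) < t := hle.lt_of_ne fun heq => hi ⟨b, heq ▸ hb⟩
  have hbi := (hw.lower_lt (hM.le _ _ hb)).trans hpi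
  obtain ⟨i', j, hij, hj, _, rfl, rfl⟩ := hM.le _ _ hb
  have hii' : i < i' := hw.lt_of_upper_lt hip hpi hlt
  rcases hM.dominates ⟨i, j, hii'.trans hij, hj, hbi, rfl, rfl⟩ with ⟨t', ht', h'⟩ | ⟨b', _, h'⟩
  · exact (ht'.trans_lt hlt).ne (hM.rightUnique h' hb)
  · exact hi ⟨b', h'⟩

lemma IsStable.bump (hmin : ∀ k < p, w p < w k → (w k : ℕ) ∉ tops M → w i ≤ w k) :
    IsStable (IsInversionBefore (p + 1) w) (adjoin M (w p) (w i)) where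
  le b t h := isInversionBefore_succ_iff.2 <| h.imp (hM.le b t)
    fun ⟨hb, ht⟩ => ⟨hb, i, hip, hpi, ht⟩
  rightUnique b t t' := by
    have hp {t : ℕ} (ht : M (w p) t) : False := (hw.lower_lt (hM.le _ _ ht)).ne rfl
    rintro (h | ⟨rfl, rfl⟩) (h' | ⟨hb, rfl⟩)
    · exact hM.rightUnique h h'
    · exact (hp (hb ▸ h)).elim
    · exact (hp h').elim
    · rfl
  leftUnique b t b' := by
    rintro (h | ⟨rfl, rfl⟩) (h' | ⟨rfl, ht⟩)
    · exact hM.leftUnique h h'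
    · exact (hi ⟨b, ht ▸ h⟩).elim
    · exact (hi ⟨_, h'⟩).elim
    · rfl
  dominates b t h := by
    rcases isInversionBefore_succ_iff.1 h with h | ⟨rfl, k, hkp, hpk, rfl⟩
    · exact (hM.dominates h).imp (fun ⟨t', ht', h'⟩ => ⟨t', ht', .inl h'⟩)
        fun ⟨b', hb', h'⟩ => ⟨b', hb', .inl h'⟩
    · by_cases hk : (w k : ℕ) ∈ tops M
      · obtain ⟨b', hb'⟩ := hk
        exact .inr ⟨b', (hw.lower_lt (hM.le _ _ hb')).le, .inl hb'⟩
      · exact .inl ⟨w i, hmin k hkp hpk hk, .inr ⟨rfl, rfl⟩⟩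

end Bump

/-- The rows of the insertion tableau of the first `m` entries of `w` are `r` and `s`, and `M`
relates each of these entries which has bumped an entry to the second row to the entry it has
bumped. The entries of the tableau are those of the one-line notation, hence shifted by `1`. -/
structure IsInsertionMatching (m : ℕ) (w : Equiv.Perm (Fin n)) (r s : List ℕ)
    (M : ℕ → ℕ → Prop) : Prop where
  sorted_fst : r.Pairwise (· < ·)
  sorted_snd : s.Pairwise (· < ·)
  mem_fst {v : ℕ} : v ∈ r ↔ ∃ i : Fin n, (i : ℕ) < m ∧ (w i : ℕ) ∉ tops M ∧ (w i : ℕ) + 1 = v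
  mem_snd {v : ℕ} : v ∈ s ↔ ∃ t ∈ tops M, t + 1 = v
  stable : IsStable (IsInversionBefore m w) M

namespace IsInsertionMatching

variable {m : ℕ} {w : Equiv.Perm (Fin n)} {r s : List ℕ} {M : ℕ → ℕ → Prop} {p : Fin n}

lemma snd_eq_nil (h : IsInsertionMatching m w r s M) (hw : Avoids321 w) (hr : r = []) :
    s = [] := by
  refine List.eq_nil_iff_forall_not_mem.2 fun v hv => ?_
  obtain ⟨t, ⟨b, hb⟩, rfl⟩ := h.mem_snd.1 hv
  have hbt := h.stable.le _ _ hb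
  obtain ⟨i, j, _, hj, _, rfl, rfl⟩ := id hbt
  have hnot : (w j : ℕ) ∉ tops M := fun ⟨b', hb'⟩ =>
    hw.isInversionRel.not_both (h.stable.le _ _ hb').isInversion hbt.isInversion
  exact List.ne_nil_of_mem (h.mem_fst.2 ⟨j, hj, hnot, rfl⟩) hr

lemma notMem_tops (h : IsInsertionMatching p w r s M) : (w p : ℕ) ∉ tops M := by
  rintro ⟨b, hb⟩
  obtain ⟨i, j, hij, hj, _, _, ht⟩ := h.stable.le _ _ hb
  exact (hij.trans hj).ne (w.injective (Fin.ext ht))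

lemma lt_bumped (h : IsInsertionMatching p w r s M) (hw : Avoids321 w) {i : Fin n} (hip : i < p)
    (hi : (w i : ℕ) ∉ tops M) (hpi : w p < w i) : ∀ v ∈ s, v < (w i : ℕ) + 1 := by
  intro v hv
  obtain ⟨t, ht, rfl⟩ := h.mem_snd.1 hv
  exact Nat.succ_lt_succ (h.stable.lt_bumped hw hip hpi hi ht)

lemma notMem_fst (h : IsInsertionMatching p w r s M) : (w p : ℕ) + 1 ∉ r := by
  intro hp
  obtain ⟨i, hi, _, hv⟩ := h.mem_fst.1 hp
  exact hi.ne (congrArg _ (w.injective (Fin.ext (Nat.succ_injective hv))))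

lemma append (h : IsInsertionMatching p w r s M) (hw : Avoids321 w)
    (hr : ∀ a ∈ r, a < (w p : ℕ) + 1) :
    IsInsertionMatching (p + 1) w (r ++ [(w p : ℕ) + 1]) s M where
  sorted_fst := List.pairwise_append.2
    ⟨h.sorted_fst, List.pairwise_singleton _ _, by simpa only [List.forall_mem_singleton] using hr⟩
  sorted_snd := h.sorted_snd
  mem_fst {v} := by
    have hp := h.notMem_tops
    rw [List.mem_append, List.mem_singleton, h.mem_fst]
    simp only [val_lt_succ_iff, or_and_right, exists_or, exists_eq_left, hp, not_false_eq_true,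
      true_and, eq_comm (a := v)]
  mem_snd := h.mem_snd
  stable := h.stable.succ_of_forall_mem_tops hw fun i hip hpi => by
    by_contra hi
    have hlt := hr _ (h.mem_fst.2 ⟨i, hip, hi, rfl⟩)
    exact hpi.not_gt (Nat.succ_lt_succ_iff.1 hlt)

lemma bump {l₁ l₂ : List ℕ} {i : Fin n}
    (h : IsInsertionMatching p w (l₁ ++ ((w i : ℕ) + 1) :: l₂) s M) (hw : Avoids321 w)
    (hip : i < p) (hi : (w i : ℕ) ∉ tops M) (hl₁ : ∀ a ∈ l₁, a < (w p : ℕ) + 1)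
    (hpi : w p < w i) :
    IsInsertionMatching (p + 1) w (l₁ ++ ((w p : ℕ) + 1) :: l₂) (s ++ [(w i : ℕ) + 1])
      (adjoin M (w p) (w i)) where
  sorted_fst := pairwise_lt_replace h.sorted_fst hl₁ (Nat.succ_lt_succ hpi)
  sorted_snd := List.pairwise_append.2
    ⟨h.sorted_snd, List.pairwise_singleton _ _, by
      simpa only [List.forall_mem_singleton] using h.lt_bumped hw hip hi hpi⟩
  mem_fst {v} := by
    have hp : (w p : ℕ) ∉ insert (w i : ℕ) (tops M) := by
      rw [Set.mem_insert_iff, not_or]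
      exact ⟨Fin.val_ne_of_ne hpi.ne, h.notMem_tops⟩
    have hnodup : (l₁ ++ ((w i : ℕ) + 1) :: l₂).Nodup := h.sorted_fst.imp LT.lt.ne
    rw [mem_replace_iff hnodup, h.mem_fst, tops_adjoin]
    simp only [val_lt_succ_iff, or_and_right, exists_or, exists_eq_left, hp, not_false_eq_true,
      true_and, eq_comm (a := v)]
    rw [or_comm]
    refine or_congr_left ⟨?_, ?_⟩
    · rintro ⟨⟨k, hkp, hk, rfl⟩, hne⟩
      exact ⟨k, hkp, by simpa [hk] using hne, rfl⟩
    · rintro ⟨k, hkp, hk, rfl⟩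
      rw [Set.mem_insert_iff, not_or] at hk
      exact ⟨⟨k, hkp, hk.2, rfl⟩, by simpa using hk.1⟩
  mem_snd {v} := by
    rw [List.mem_append, List.mem_singleton, h.mem_snd, tops_adjoin, Set.exists_mem_insert,
      or_comm, eq_comm]
  stable := h.stable.bump hw hip hpi hi fun k hkp hpk hk =>
    Nat.succ_le_succ_iff.1 <| le_of_mem_append_cons h.sorted_fst hl₁
      (h.mem_fst.2 ⟨k, hkp, hk, rfl⟩) (Nat.succ_lt_succ hpk)

lemma exists_succ (h : IsInsertionMatching p w r s M) (hw : Avoids321 w) :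
    ∃ r' s' M', IsInsertionMatching (p + 1) w r' s' M' ∧
      tableauInsert (twoRows r s) (w p + 1) = twoRows r' s' := by
  rcases forall_lt_or_exists_eq_append_cons h.notMem_fst with hr | ⟨l₁, z, l₂, rfl, hl₁, hz⟩
  · exact ⟨_, _, _, h.append hw hr, tableauInsert_twoRows_of_forall_lt hr (h.snd_eq_nil hw)⟩
  · obtain ⟨i, hip, hi, rfl⟩ := h.mem_fst.1 (show z ∈ l₁ ++ z :: l₂ by simp)
    have hpi : w p < w i := Nat.succ_lt_succ_iff.1 hz
    exact ⟨_, _, _, h.bump hw hip hi hl₁ hpi,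
      tableauInsert_twoRows_append_cons hl₁ hz (h.lt_bumped hw hip hi hpi)⟩

end IsInsertionMatching

lemma isInsertionMatching_zero (w : Equiv.Perm (Fin n)) :
    IsInsertionMatching 0 w [] [] fun _ _ => False where
  sorted_fst := .nil
  sorted_snd := .nil
  mem_fst := by simp
  mem_snd := by simp [tops]
  stable :=
    { le := fun _ _ => False.elim
      rightUnique := fun _ _ _ => False.elim
      leftUnique := fun _ _ _ => False.elim
      dominates := fun _ _ ⟨_, _, _, hj, _⟩ => absurd hj (Nat.not_lt_zero _) }

lemma exists_isInsertionMatching_take {w : Equiv.Perm (Fin n)} (hw : Avoids321 w) {m : ℕ}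
    (hm : m ≤ n) : ∃ r s M, IsInsertionMatching m w r s M ∧
      ((oneLine w).take m).foldl tableauInsert [] = twoRows r s := by
  induction m with
  | zero => exact ⟨[], [], _, isInsertionMatching_zero w, rfl⟩
  | succ m ih =>
    obtain ⟨r, s, M, h, htab⟩ := ih (Nat.le_of_succ_le hm)
    obtain ⟨r', s', M', h', htab'⟩ := h.exists_succ (p := ⟨m, hm⟩) hw
    refine ⟨r', s', M', h', ?_⟩
    rw [List.take_add_one, List.foldl_append, htab, ← htab']
    simp [oneLine, Nat.lt_of_succ_le hm]

lemma Avoids321.exists_isInsertionMatching {w : Equiv.Perm (Fin n)} (hw : Avoids321 w) :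
    ∃ r s M, IsInsertionMatching n w r s M ∧ insertionTableau w = twoRows r s := by
  obtain ⟨r, s, M, h, htab⟩ := exists_isInsertionMatching_take hw le_rfl
  rw [List.take_of_length_le (by simp [oneLine])] at htab
  exact ⟨r, s, M, h, htab⟩

namespace IsInsertionMatching

variable {w : Equiv.Perm (Fin n)} {r s : List ℕ} {M : ℕ → ℕ → Prop}

lemma isStable (h : IsInsertionMatching n w r s M) : IsStable (IsInversion w) M :=
  isInversionBefore_eq_isInversion w ▸ h.stable

lemma isUncrowdedTableau_iff (h : IsInsertionMatching n w r s M) (hw : Avoids321 w) :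
    IsUncrowdedTableau (twoRows r s) ↔ UncrowdedNat (tops M) := by
  have himage : {z : ℤ | ∃ q ∈ s, (q : ℤ) = z} = (fun t : ℕ => (t : ℤ) + 1) '' tops M := by
    ext z
    simp [h.mem_snd]
  rw [IsUncrowdedTableau, rowTwo_twoRows (h.snd_eq_nil hw), himage, isUncrowdedSet_image_iff]
  exact and_iff_right (length_twoRows_le r s)

lemma twoRows_eq {c : Equiv.Perm (Fin n)} {r' s' : List ℕ} {N : ℕ → ℕ → Prop}
    (h : IsInsertionMatching n w r s M) (h' : IsInsertionMatching n c r' s' N)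
    (htops : tops M = tops N) : twoRows r s = twoRows r' s' := by
  have hreindex (v : ℕ) (u : Equiv.Perm (Fin n)) :
      (∃ i : Fin n, (i : ℕ) < n ∧ (u i : ℕ) ∉ tops N ∧ (u i : ℕ) + 1 = v) ↔
        ∃ x : Fin n, (x : ℕ) ∉ tops N ∧ (x : ℕ) + 1 = v := by
    simpa using u.exists_congr_left (p := fun i => (u i : ℕ) ∉ tops N ∧ (u i : ℕ) + 1 = v)
  have hfst : r = r' := h.sorted_fst.eq_of_mem_iff h'.sorted_fst fun v => by
    rw [h.mem_fst, h'.mem_fst, htops, hreindex, hreindex]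
  have hsnd : s = s' := h.sorted_snd.eq_of_mem_iff h'.sorted_snd fun v => by
    rw [h.mem_snd, h'.mem_snd, htops]
  rw [hfst, hsnd]

end IsInsertionMatching

end FCPerm

theorem corollary4p12 (n : ℕ) (w : Equiv.Perm (Fin n)) (hw : FCPerm.IsFullyCommutative w) :
    (∃! c : Equiv.Perm (Fin n), FCPerm.IsBooleanCore c w) ∧
      ∀ c : Equiv.Perm (Fin n), FCPerm.IsBooleanCore c w →
        (FCPerm.IsUncrowded w ↔ FCPerm.insertionTableau c = FCPerm.insertionTableau w) := by
  have hav := hw.braidFree.avoids321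
  obtain ⟨c, hc⟩ := hw.braidFree.exists_isBooleanCore
  refine ⟨⟨c, hc, fun c' hc' => hc'.unique hc hav⟩, fun c hc => ?_⟩
  have hcav := hc.avoids321 hav
  obtain ⟨r, s, M, hM, htab⟩ := hav.exists_isInsertionMatching
  obtain ⟨r', s', N, hN, htab'⟩ := hcav.exists_isInsertionMatching
  constructor
  · intro h
    rw [FCPerm.IsUncrowded, htab, hM.isUncrowdedTableau_iff hav] at h
    have hNstable := hc.isInversion_eq_innermost hav ▸ hN.isStable
    rw [htab, htab']
    exact hN.twoRows_eq hM (FCPerm.tops_innermost_eq hav.isInversionRel hM.isStable hNstable h)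
  · intro h
    rw [FCPerm.IsUncrowded, ← h, htab', hN.isUncrowdedTableau_iff hcav]
    exact hN.isStable.uncrowdedNat_tops hcav.isInversionRel
      (hc.1.thinCuts.encard_crossing_le hN.isStable)
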